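/- Let $P_1,P_0$ be probability measures on $\mathbb{R}^p$. A classification rule is a measurable $g:\mathbb{R}^p\to\{0,1\}$; its risk is $\mathcal{C}(g)=\frac12\big(P_1(g\neq 1)+P_0(g\neq 0)\big)$. Let $g^*=1_V$, $V=\{dP_1\ge dP_0\}$, be the optimal rule, where $dP_1,dP_0$ denote the densities with respect to $P_1+P_0$ (if $P_1,P_0$ are equivalent, $V=\{\log\frac{dP_1}{dP_0}\ge 0\}$ up to a null set). The learning error of $g$ is $$\mathcal{R}(g)=\tfrac12\Big(P_1(g\neq 1,\ g^*=1)+P_0(g\neq 0,\ g^*=0)\Big),$$ and $d_1(P_1,P_0)=\int|dP_1-dP_0|$. 1. Let $p\ge 0$, let $C$ be a symmetric positive definite $p\times p$ matrix, and let $P_1=\mathcal N(\mu_1,C)$, $P_0=\mathcal N(\mu_0,C)$, $m=\mu_1-\mu_0$. Then for every measurable $g:\mathbb{R}^p\to\{0,1\}$, $$\mathcal{C}(g)-\mathcal{C}(g^*)\ \ge\ \min\Big\{\frac{\sqrt{2\pi}}{2\cdot 16^2}\,\|C^{-1/2}m\|\,e^{\|C^{-1/2}m\|^2/8}\,\mathcal{R}(g)^2,\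 \frac{\mathcal{R}(g)}{8}\Big\}.$$ 2. For every $c_1>0$ there is a constant $c(c_1)>0$, depending only on $c_1$ (in particular not on the dimension $p$), such that for every $p$, all Gaussian measures $P_1,P_0$ on $\mathbb{R}^p$ with $d_1(P_1,P_0)>c_1$, and every measurable $g:\mathbb{R}^p\to\{0,1\}$, $$\mathcal{C}(g)-\mathcal{C}(g^*)\ \ge\ \min\Big\{c(c_1)\,\mathcal{R}(g)^8,\ \frac{\mathcal{R}(g)}{8}\Big\}.$$ -/

import Mathlib

open MeasureTheory ProbabilityTheory
open scoped MatrixOrder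

noncomputable section

namespace GaussianClassification

variable {X : Type*} [MeasurableSpace X]

/-- The Radon-Nikodym density of `P` with respect to the measure `P₁ + P₀`, which dominates both
class distributions. -/
def density (P₁ P₀ P : Measure X) (x : X) : ℝ :=
  (P.rnDeriv (P₁ + P₀) x).toReal

/-- The acceptance region `V = {dP₁ ≥ dP₀}` of class `1`. When `P₁` and `P₀` are equivalent this is,
up to a null set, the set where the log-likelihood ratio `log (dP₁/dP₀)` is nonnegative. Comparing
the densities with respect to `P₁ + P₀` makes sense also when `P₁` and `P₀` are not equivalent. -/
def optimalRegion (P₁ P₀ : Measure X) : Set X :=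
  {x | density P₁ P₀ P₀ x ≤ density P₁ P₀ P₁ x}

open Classical in
/-- The optimal rule `g* = 1_V`. -/
def optimalRule (P₁ P₀ : Measure X) (x : X) : Fin 2 :=
  if x ∈ optimalRegion P₁ P₀ then 1 else 0

/-- The classification error `C(g) = (P₁(g ≠ 1) + P₀(g ≠ 0)) / 2`. -/
def risk (P₁ P₀ : Measure X) (g : X → Fin 2) : ℝ :=
  (1 / 2) * (P₁.real {x | g x ≠ 1} + P₀.real {x | g x ≠ 0})

/-- The excess risk `C(g) - C(g*)`. -/
def excessRisk (P₁ P₀ : Measure X) (g : X → Fin 2) : ℝ :=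
  risk P₁ P₀ g - risk P₁ P₀ (optimalRule P₁ P₀)

/-- The learning error `R(g)`: the probability, for a uniform label, that `g` is wrong and `g*` is
right. -/
def learningError (P₁ P₀ : Measure X) (g : X → Fin 2) : ℝ :=
  (1 / 2) * (P₁.real {x | g x ≠ 1 ∧ optimalRule P₁ P₀ x = 1} +
    P₀.real {x | g x ≠ 0 ∧ optimalRule P₁ P₀ x = 0})

/-- The `L¹` distance `d₁(P₁, P₀) = ∫ |dP₁ - dP₀|`. -/
def l1Dist (P₁ P₀ : Measure X) : ℝ :=
  ∫ x, |density P₁ P₀ P₁ x - density P₁ P₀ P₀ x| ∂(P₁ + P₀)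

end GaussianClassification

/-- The norm `‖C^{-1/2} m‖` for a positive definite matrix `C`. -/
def GaussianClassification.whitenedNorm {p : ℕ} (C : Matrix (Fin p) (Fin p) ℝ)
    (m : EuclideanSpace ℝ (Fin p)) : ℝ :=
  ‖Matrix.toEuclideanCLM (𝕜 := ℝ) (CFC.sqrt C)⁻¹ m‖

end

/-!
Write `V` for the acceptance region, and `l` for the log-likelihood ratio `log (dP₁/dP₀)` when it
exists. A wrong decision at a point costs the difference of the two densities there, whereas the
learning error counts the larger one. Where `|l| > 2ε` the difference is at least `ε` times the
larger density, so that (`mul_sub_le_excessRisk`) for `ε ≤ 1/4`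
`C(g) - C(g*) ≥ ε (R(g) - 3/2 · P₀(|l| ≤ 2ε))`,
and everything reduces to a small ball estimate for the law of `l` under `P₀`, used with an `ε` for
which the discarded mass is at most `R(g) / 2`.

For a common covariance, the Cameron–Martin formula makes `l` affine and its law `N(-δ²/2, δ²)` with
`δ = ‖C^{-1/2} m‖` (`exists_logLikelihood_of_posDef`). Its density near the origin is at most a
constant times `exp (-δ²/8) / δ`, hence `P₀(|l| ≤ 2ε)` is linear in `ε`, which gives the quadratic
bound.

For general Gaussian classes, a common congruence diagonalizes both covariances, degenerate or not
(`exists_simultaneous_diagonalization`), so both measures become products of Gaussian measures on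
the line. If in some coordinate the factors are mutually singular, then so are `P₁` and `P₀`, and
the excess risk equals the learning error. Otherwise `l` is a sum of independent terms, each distributed
as `aᵢ z² + bᵢ z + cᵢ` with `z` standard Gaussian. An explicit Gaussian integral bounds each
characteristic function by `(1 + 2 s² vᵢ)^(-1/4)` with `vᵢ = 2 aᵢ² + bᵢ²`; the product is then at
most `(1 + 2 s² ∑ vᵢ)^(-1/4)`, in which the dimension no longer appears
(`norm_charFun_sum_pow_four_le`). Gaussian smoothing turns this into `P₀(|l| ≤ η³) = O(η)` with a
constant depending on a lower bound for `∑ vᵢ` only (`real_abs_le_cube_of_norm_charFun_le`). This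
yields a bound of the order `R(g)⁴`, which dominates `R(g)⁸` because `R(g) ≤ 1`.

The lower bound for `∑ vᵢ` comes from the `L¹` distance: `d₁(P₁, P₀) ≤ 2 ∫ |l| dP₀`, and the
normalization `∫ exp l dP₀ = 1` ties the mean of `l` to its variance, so that a small `∑ vᵢ` forces
`∫ |l| dP₀`, hence the distance, to be small (`integral_abs_sum_le`).
-/

/-! ### Excess risk and learning error in terms of the two classes -/

namespace GaussianClassification

variable {X : Type*} [MeasurableSpace X]

lemma measurable_density (P₁ P₀ P : Measure X) : Measurable (density P₁ P₀ P) :=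
  (Measure.measurable_rnDeriv _ _).ennreal_toReal

lemma measurableSet_optimalRegion (P₁ P₀ : Measure X) :
    MeasurableSet (optimalRegion P₁ P₀) :=
  measurableSet_le (measurable_density _ _ _) (measurable_density _ _ _)

lemma optimalRule_eq_one_iff (P₁ P₀ : Measure X) (x : X) :
    optimalRule P₁ P₀ x = 1 ↔ x ∈ optimalRegion P₁ P₀ := by
  unfold optimalRule; split_ifs <;> simp_all

lemma optimalRule_eq_zero_iff (P₁ P₀ : Measure X) (x : X) :
    optimalRule P₁ P₀ x = 0 ↔ x ∉ optimalRegion P₁ P₀ := by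
  unfold optimalRule; split_ifs <;> simp_all

lemma real_eq_setIntegral_density_left (P₁ P₀ : Measure X) [IsFiniteMeasure P₁]
    [IsFiniteMeasure P₀] (A : Set X) :
    P₁.real A = ∫ x in A, density P₁ P₀ P₁ x ∂(P₁ + P₀) :=
  (Measure.setIntegral_toReal_rnDeriv (rfl.absolutelyContinuous.add_right _) A).symm

lemma real_eq_setIntegral_density_right (P₁ P₀ : Measure X) [IsFiniteMeasure P₁]
    [IsFiniteMeasure P₀] (A : Set X) :
    P₀.real A = ∫ x in A, density P₁ P₀ P₀ x ∂(P₁ + P₀) :=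
  (Measure.setIntegral_toReal_rnDeriv
    (by rw [add_comm]; exact rfl.absolutelyContinuous.add_right _) A).symm

lemma integrable_density (P₁ P₀ P : Measure X) [IsFiniteMeasure P] :
    Integrable (density P₁ P₀ P) (P₁ + P₀) :=
  Measure.integrable_toReal_rnDeriv

lemma learningError_eq (P₁ P₀ : Measure X) (g : X → Fin 2) :
    learningError P₁ P₀ g = 1 / 2 *
      (P₁.real (g ⁻¹' {0} ∩ optimalRegion P₁ P₀) +
        P₀.real (g ⁻¹' {1} ∩ (optimalRegion P₁ P₀)ᶜ)) := by
  have a1 : {x | g x ≠ 1 ∧ optimalRule P₁ P₀ x = 1} = g ⁻¹' {0} ∩ optimalRegion P₁ P₀ := by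
    ext x; simp [optimalRule_eq_one_iff]; omega
  have a0 : {x | g x ≠ 0 ∧ optimalRule P₁ P₀ x = 0} = g ⁻¹' {1} ∩ (optimalRegion P₁ P₀)ᶜ := by
    ext x; simp [optimalRule_eq_zero_iff]; omega
  rw [learningError, a1, a0]

lemma learningError_nonneg (P₁ P₀ : Measure X) (g : X → Fin 2) : 0 ≤ learningError P₁ P₀ g := by
  rw [learningError]; positivity

section

variable (P₁ P₀ : Measure X) [IsProbabilityMeasure P₁] [IsProbabilityMeasure P₀]

/-- Inside the acceptance region the first class carries more mass. -/
lemma real_right_le_left_of_subset {A : Set X} (hA : MeasurableSet A)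
    (h : A ⊆ optimalRegion P₁ P₀) : P₀.real A ≤ P₁.real A := by
  rw [real_eq_setIntegral_density_left P₁ P₀, real_eq_setIntegral_density_right P₁ P₀]
  exact setIntegral_mono_on (integrable_density _ _ _).integrableOn
    (integrable_density _ _ _).integrableOn hA fun x hx => h hx

/-- Outside the acceptance region the second class carries more mass. -/
lemma real_left_le_right_of_subset_compl {A : Set X} (hA : MeasurableSet A)
    (h : A ⊆ (optimalRegion P₁ P₀)ᶜ) : P₁.real A ≤ P₀.real A := by
  rw [real_eq_setIntegral_density_left P₁ P₀, real_eq_setIntegral_density_right P₁ P₀]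
  exact setIntegral_mono_on (integrable_density _ _ _).integrableOn
    (integrable_density _ _ _).integrableOn hA fun x hx =>
      (not_le.1 (Set.mem_compl_iff _ _ |>.1 (h hx))).le

lemma l1Dist_eq : l1Dist P₁ P₀ =
    2 * (P₀.real (optimalRegion P₁ P₀)ᶜ - P₁.real (optimalRegion P₁ P₀)ᶜ) := by
  have hV := measurableSet_optimalRegion P₁ P₀
  have h1 := integrable_density P₁ P₀ P₁
  have h0 := integrable_density P₁ P₀ P₀
  have e1 : ∫ x in optimalRegion P₁ P₀, |density P₁ P₀ P₁ x - density P₁ P₀ P₀ x| ∂(P₁ + P₀)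
      = P₁.real (optimalRegion P₁ P₀) - P₀.real (optimalRegion P₁ P₀) := by
    rw [real_eq_setIntegral_density_left P₁ P₀, real_eq_setIntegral_density_right P₁ P₀,
      ← integral_sub h1.integrableOn h0.integrableOn]
    exact setIntegral_congr_fun hV fun x hx => abs_of_nonneg (sub_nonneg.2 hx)
  have e0 : ∫ x in (optimalRegion P₁ P₀)ᶜ,
        |density P₁ P₀ P₁ x - density P₁ P₀ P₀ x| ∂(P₁ + P₀)
      = P₀.real (optimalRegion P₁ P₀)ᶜ - P₁.real (optimalRegion P₁ P₀)ᶜ := by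
    rw [real_eq_setIntegral_density_left P₁ P₀, real_eq_setIntegral_density_right P₁ P₀,
      ← integral_sub h0.integrableOn h1.integrableOn]
    refine setIntegral_congr_fun hV.compl fun x hx => ?_
    have : density P₁ P₀ P₁ x < density P₁ P₀ P₀ x := not_le.1 hx
    simp only [abs_of_neg (sub_neg.2 this), neg_sub]
  rw [l1Dist, ← integral_add_compl hV (f := fun x => |density P₁ P₀ P₁ x - density P₁ P₀ P₀ x|)
    (h1.sub h0).abs, e1, e0, probReal_compl_eq_one_sub hV,
    probReal_compl_eq_one_sub hV]
  ring

/-- The excess risk in terms of the two sets where `g` differs from the optimal rule. -/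
lemma excessRisk_eq {g : X → Fin 2} (hg : Measurable g) :
    excessRisk P₁ P₀ g = 1 / 2 *
      ((P₁.real (g ⁻¹' {0} ∩ optimalRegion P₁ P₀) - P₀.real (g ⁻¹' {0} ∩ optimalRegion P₁ P₀)) +
      (P₀.real (g ⁻¹' {1} ∩ (optimalRegion P₁ P₀)ᶜ)
        - P₁.real (g ⁻¹' {1} ∩ (optimalRegion P₁ P₀)ᶜ))) := by
  have hV := measurableSet_optimalRegion P₁ P₀
  have a1 : {x | g x ≠ 1} = g ⁻¹' {0} := by
    ext x; simp; omega
  have a0 : {x | g x ≠ 0} = g ⁻¹' {1} := by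
    ext x; simp; omega
  have b1 : {x | optimalRule P₁ P₀ x ≠ 1} = (optimalRegion P₁ P₀)ᶜ := by
    ext x; simp [optimalRule_eq_one_iff]
  have b0 : {x | optimalRule P₁ P₀ x ≠ 0} = optimalRegion P₁ P₀ := by
    ext x; simp [optimalRule_eq_zero_iff]
  have hc : g ⁻¹' {1} = (g ⁻¹' {0})ᶜ := by
    ext x; simp; omega
  have hm : MeasurableSet (g ⁻¹' {0}) := hg (measurableSet_singleton _)
  have split (P : Measure X) [IsProbabilityMeasure P] (A : Set X) {B : Set X}
      (hB : MeasurableSet B) : P.real A = P.real (A ∩ B) + P.real (A ∩ Bᶜ) := by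
    rw [← Set.sdiff_eq, measureReal_inter_add_sdiff hB]
  rw [excessRisk, risk, risk, a1, a0, b1, b0, split P₁ (g ⁻¹' {0}) hV, split P₀ (g ⁻¹' {1}) hV,
    split P₁ (optimalRegion P₁ P₀)ᶜ hm, split P₀ (optimalRegion P₁ P₀) hm, hc,
    Set.inter_comm _ (g ⁻¹' {0}), Set.inter_comm _ (g ⁻¹' {0}), Set.inter_comm _ (g ⁻¹' {0})ᶜ,
    Set.inter_comm _ (g ⁻¹' {0})ᶜ]
  ring

lemma learningError_le_one (g : X → Fin 2) : learningError P₁ P₀ g ≤ 1 := by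
  rw [learningError]
  have h1 := measureReal_le_one (μ := P₁) (s := {x | g x ≠ 1 ∧ optimalRule P₁ P₀ x = 1})
  have h0 := measureReal_le_one (μ := P₀) (s := {x | g x ≠ 0 ∧ optimalRule P₁ P₀ x = 0})
  linarith

lemma excessRisk_nonneg {g : X → Fin 2} (hg : Measurable g) : 0 ≤ excessRisk P₁ P₀ g := by
  have hV := measurableSet_optimalRegion P₁ P₀
  have h1 := real_right_le_left_of_subset P₁ P₀
    ((hg (measurableSet_singleton 0)).inter hV) Set.inter_subset_right
  have h0 := real_left_le_right_of_subset_compl P₁ P₀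
    ((hg (measurableSet_singleton 1)).inter hV.compl) Set.inter_subset_right
  rw [excessRisk_eq P₁ P₀ hg]
  linarith

/-- For mutually singular classes the wrong label is always avoidable, so that nothing is lost in
passing from the learning error to the excess risk. -/
lemma excessRisk_eq_learningError_of_mutuallySingular (h : P₁ ⟂ₘ P₀) {g : X → Fin 2}
    (hg : Measurable g) : excessRisk P₁ P₀ g = learningError P₁ P₀ g := by
  have hV := measurableSet_optimalRegion P₁ P₀
  obtain ⟨N, hN, h1, h0⟩ := h
  -- on `N` the first class has no mass, so that inside `V` neither has the second one
  have key1 (A : Set X) (hA : MeasurableSet A) (hAV : A ⊆ optimalRegion P₁ P₀) :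
      P₀.real A = 0 := by
    have l1 := real_right_le_left_of_subset P₁ P₀ (hA.inter hN)
      (Set.inter_subset_left.trans hAV)
    have l2 : P₁.real (A ∩ N) = 0 := by
      simp [measureReal_def, measure_mono_null Set.inter_subset_right h1]
    have l3 : P₀.real (A \ N) = 0 := by
      simp [measureReal_def, measure_mono_null (fun x hx => hx.2 : A \ N ⊆ Nᶜ) h0]
    rw [← measureReal_inter_add_sdiff hN (s := A), l3]
    linarith [measureReal_nonneg (μ := P₀) (s := A ∩ N)]
  have key0 (A : Set X) (hA : MeasurableSet A) (hAV : A ⊆ (optimalRegion P₁ P₀)ᶜ) :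
      P₁.real A = 0 := by
    have l1 := real_left_le_right_of_subset_compl P₁ P₀ (hA.diff hN)
      (Set.sdiff_subset.trans hAV)
    have l2 : P₁.real (A ∩ N) = 0 := by
      simp [measureReal_def, measure_mono_null Set.inter_subset_right h1]
    have l3 : P₀.real (A \ N) = 0 := by
      simp [measureReal_def, measure_mono_null (fun x hx => hx.2 : A \ N ⊆ Nᶜ) h0]
    rw [← measureReal_inter_add_sdiff hN (s := A), l2]
    linarith [measureReal_nonneg (μ := P₁) (s := A \ N)]
  rw [excessRisk_eq P₁ P₀ hg, learningError_eq,
    key1 _ ((hg (measurableSet_singleton 0)).inter hV) Set.inter_subset_right,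
    key0 _ ((hg (measurableSet_singleton 1)).inter hV.compl) Set.inter_subset_right]
  ring

end

section LogLikelihood

variable {P₁ P₀ : Measure X} {l : X → ℝ}

lemma real_le_exp_mul_real [IsFiniteMeasure P₀]
    (h : P₁ = P₀.withDensity fun x => ENNReal.ofReal (Real.exp (l x))) {A : Set X}
    (hA : MeasurableSet A) {t : ℝ} (ht : ∀ x ∈ A, l x ≤ t) :
    P₁.real A ≤ Real.exp t * P₀.real A := by
  have : P₁ A ≤ ENNReal.ofReal (Real.exp t) * P₀ A := by
    rw [h, withDensity_apply _ hA, ← setLIntegral_const]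
    exact setLIntegral_mono measurable_const fun x hx =>
      ENNReal.ofReal_le_ofReal (Real.exp_le_exp.2 (ht x hx))
  have h2 := ENNReal.toReal_mono
    (ENNReal.mul_ne_top ENNReal.ofReal_ne_top (measure_ne_top _ _)) this
  rwa [ENNReal.toReal_mul, ENNReal.toReal_ofReal (Real.exp_nonneg _)] at h2

lemma exp_mul_real_le_real [IsFiniteMeasure P₁] (hl : Measurable l)
    (h : P₁ = P₀.withDensity fun x => ENNReal.ofReal (Real.exp (l x))) {A : Set X}
    (hA : MeasurableSet A) {t : ℝ} (ht : ∀ x ∈ A, t ≤ l x) :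
    Real.exp t * P₀.real A ≤ P₁.real A := by
  have : ENNReal.ofReal (Real.exp t) * P₀ A ≤ P₁ A := by
    rw [h, withDensity_apply _ hA, ← setLIntegral_const]
    exact setLIntegral_mono (by fun_prop) fun x hx =>
      ENNReal.ofReal_le_ofReal (Real.exp_le_exp.2 (ht x hx))
  have h2 := ENNReal.toReal_mono (measure_ne_top _ _) this
  rwa [ENNReal.toReal_mul, ENNReal.toReal_ofReal (Real.exp_nonneg _)] at h2

lemma real_eq_add_inter_of_levels (P : Measure X) [IsFiniteMeasure P] (hl : Measurable l)
    {t : ℝ} (ht : 0 ≤ t) (A : Set X) :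
    P.real A = P.real (A ∩ {x | t < l x}) + P.real (A ∩ {x | |l x| ≤ t}) +
      P.real (A ∩ {x | l x < -t}) := by
  have m1 : MeasurableSet {x | t < l x} := measurableSet_lt measurable_const hl
  have m2 : MeasurableSet {x | l x < -t} := measurableSet_lt hl measurable_const
  have e1 : (A \ {x | t < l x}) ∩ {x | l x < -t} = A ∩ {x | l x < -t} := by
    ext x
    simp only [Set.mem_inter_iff, Set.mem_sdiff, Set.mem_ofPred_eq, not_lt]
    constructor
    · rintro ⟨⟨h1, -⟩, h2⟩; exact ⟨h1, h2⟩
    · rintro ⟨h1, h2⟩; exact ⟨⟨h1, by linarith⟩, h2⟩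
  have e2 : (A \ {x | t < l x}) \ {x | l x < -t} = A ∩ {x | |l x| ≤ t} := by
    ext x
    simp only [Set.mem_inter_iff, Set.mem_sdiff, Set.mem_ofPred_eq, not_lt, abs_le]
    tauto
  rw [← measureReal_inter_add_sdiff m1 (s := A),
    ← measureReal_inter_add_sdiff m2 (s := A \ {x | t < l x}), e1, e2]
  ring

/-- The margin argument: where the log-likelihood ratio `l` exceeds `2 * ε` in absolute value, a
wrong decision costs at least the fraction `ε` of the larger density, so only the mass of the
region `|l| ≤ 2 * ε` has to be discarded. -/
lemma mul_sub_le_excessRisk [IsProbabilityMeasure P₁] [IsProbabilityMeasure P₀]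
    (hl : Measurable l) (h : P₁ = P₀.withDensity fun x => ENNReal.ofReal (Real.exp (l x)))
    {g : X → Fin 2} (hg : Measurable g) {ε : ℝ} (h0 : 0 < ε) (h1 : ε ≤ 1 / 4) :
    ε * (learningError P₁ P₀ g - 3 / 2 * P₀.real {x | |l x| ≤ 2 * ε}) ≤ excessRisk P₁ P₀ g := by
  have hV := measurableSet_optimalRegion P₁ P₀
  have mA := (hg (measurableSet_singleton 0)).inter hV
  have mD := (hg (measurableSet_singleton 1)).inter hV.compl
  have mhi : MeasurableSet {x | 2 * ε < l x} := measurableSet_lt measurable_const hl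
  have mlo : MeasurableSet {x | l x < -(2 * ε)} := measurableSet_lt hl measurable_const
  have mmid : MeasurableSet {x | |l x| ≤ 2 * ε} := measurableSet_le hl.abs measurable_const
  have t0 : 0 ≤ 2 * ε := by linarith
  rw [excessRisk_eq P₁ P₀ hg, learningError_eq]
  set A := g ⁻¹' {0} ∩ optimalRegion P₁ P₀
  set D := g ⁻¹' {1} ∩ (optimalRegion P₁ P₀)ᶜ
  have sA : A ⊆ optimalRegion P₁ P₀ := Set.inter_subset_right
  have sD : D ⊆ (optimalRegion P₁ P₀)ᶜ := Set.inter_subset_right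
  have he : 1 + 2 * ε ≤ Real.exp (2 * ε) := by linarith [Real.add_one_le_exp (2 * ε)]
  have he1 : (1 - ε) * Real.exp (2 * ε) ≥ 1 := by nlinarith
  have he2 : Real.exp (2 * ε) ≤ 2 := by
    refine (Real.exp_le_exp.2 (by linarith : 2 * ε ≤ 1 / 2)).trans ?_
    have := Real.exp_bound_div_one_sub_of_interval (x := 1 / 2) (by norm_num) (by norm_num)
    norm_num at this ⊢
    exact this
  have hneg : Real.exp (-(2 * ε)) ≤ 1 - ε := by
    rw [Real.exp_neg, inv_le_iff_one_le_mul₀ (Real.exp_pos _)]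
    exact he1
  -- the likelihood bounds on the three levels of `l`; where `l` has the sign opposite to the one
  -- prescribed by `V`, they combine with the inequality coming from `V` to give measure zero
  have hA1 := exp_mul_real_le_real hl h (mA.inter mhi) (t := 2 * ε) fun x hx => hx.2.le
  have hA2 := real_right_le_left_of_subset P₁ P₀ (mA.inter mmid)
    (Set.inter_subset_left.trans sA)
  have hA3 := real_right_le_left_of_subset P₁ P₀ (mA.inter mlo)
    (Set.inter_subset_left.trans sA)
  have hA4 := real_le_exp_mul_real h (mA.inter mlo) (t := -(2 * ε)) fun x hx => hx.2.le
  have hA5 := real_le_exp_mul_real h (mA.inter mmid) (t := 2 * ε)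
    fun x hx => (abs_le.1 hx.2).2
  have hD1 := exp_mul_real_le_real hl h (mD.inter mhi) (t := 2 * ε) fun x hx => hx.2.le
  have hD2 := real_left_le_right_of_subset_compl P₁ P₀ (mD.inter mmid)
    (Set.inter_subset_left.trans sD)
  have hD3 := real_left_le_right_of_subset_compl P₁ P₀ (mD.inter mhi)
    (Set.inter_subset_left.trans sD)
  have hD4 := real_le_exp_mul_real h (mD.inter mlo) (t := -(2 * ε)) fun x hx => hx.2.le
  have hA6 : P₀.real (A ∩ {x | |l x| ≤ 2 * ε}) ≤ P₀.real {x | |l x| ≤ 2 * ε} :=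
    measureReal_mono Set.inter_subset_right
  have hD6 : P₀.real (D ∩ {x | |l x| ≤ 2 * ε}) ≤ P₀.real {x | |l x| ≤ 2 * ε} :=
    measureReal_mono Set.inter_subset_right
  rw [real_eq_add_inter_of_levels P₁ hl t0 A, real_eq_add_inter_of_levels P₀ hl t0 A,
    real_eq_add_inter_of_levels P₁ hl t0 D, real_eq_add_inter_of_levels P₀ hl t0 D]
  have n1 := measureReal_nonneg (μ := P₀) (s := A ∩ {x | 2 * ε < l x})
  have n2 := measureReal_nonneg (μ := P₀) (s := A ∩ {x | l x < -(2 * ε)})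
  have n3 := measureReal_nonneg (μ := P₀) (s := D ∩ {x | 2 * ε < l x})
  have n4 := measureReal_nonneg (μ := P₀) (s := D ∩ {x | l x < -(2 * ε)})
  have n5 := measureReal_nonneg (μ := P₀) (s := A ∩ {x | |l x| ≤ 2 * ε})
  generalize P₀.real {x | |l x| ≤ 2 * ε} = b at *
  generalize P₀.real (A ∩ {x | 2 * ε < l x}) = a1 at *
  generalize P₀.real (A ∩ {x | |l x| ≤ 2 * ε}) = a2 at *
  generalize P₀.real (A ∩ {x | l x < -(2 * ε)}) = a3 at *
  generalize P₁.real (A ∩ {x | 2 * ε < l x}) = A1 at *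
  generalize P₁.real (A ∩ {x | |l x| ≤ 2 * ε}) = A2 at *
  generalize P₁.real (A ∩ {x | l x < -(2 * ε)}) = A3 at *
  generalize P₀.real (D ∩ {x | 2 * ε < l x}) = d1 at *
  generalize P₀.real (D ∩ {x | |l x| ≤ 2 * ε}) = d2 at *
  generalize P₀.real (D ∩ {x | l x < -(2 * ε)}) = d3 at *
  generalize P₁.real (D ∩ {x | 2 * ε < l x}) = D1 at *
  generalize P₁.real (D ∩ {x | |l x| ≤ 2 * ε}) = D2 at *
  generalize P₁.real (D ∩ {x | l x < -(2 * ε)}) = D3 at *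
  have k1 : a1 ≤ (1 - ε) * A1 := by
    have := mul_le_mul_of_nonneg_left hA1 (by linarith : 0 ≤ 1 - ε)
    nlinarith
  have k2 : a3 = 0 := by nlinarith [mul_le_mul_of_nonneg_right hneg n2]
  have k3 : A3 ≤ 0 := by rw [k2, mul_zero] at hA4; exact hA4
  have k4 : d1 = 0 := by nlinarith [mul_le_mul_of_nonneg_right he n3]
  have k5 : D3 ≤ (1 - ε) * d3 := hD4.trans (mul_le_mul_of_nonneg_right hneg n4)
  have k6 : A2 ≤ 2 * b := by nlinarith [mul_le_mul_of_nonneg_right he2 n5]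
  have k7 : ε * (A2 + d2) ≤ ε * (3 * b) := mul_le_mul_of_nonneg_left (by linarith) h0.le
  have k8 : ε * A3 ≤ 0 := mul_nonpos_of_nonneg_of_nonpos h0.le k3
  have k9 : ε * d1 = 0 := by rw [k4, mul_zero]
  linarith

/-- As `1 - exp l ≤ |l|`, the first moment of the log-likelihood ratio bounds the `L¹` distance. -/
lemma l1Dist_le [IsProbabilityMeasure P₁] [IsProbabilityMeasure P₀]
    (hl : Measurable l) (h : P₁ = P₀.withDensity fun x => ENNReal.ofReal (Real.exp (l x)))
    (hi : Integrable l P₀) : l1Dist P₁ P₀ ≤ 2 * ∫ x, |l x| ∂P₀ := by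
  have hV := (measurableSet_optimalRegion P₁ P₀).compl
  rw [l1Dist_eq]
  set W := (optimalRegion P₁ P₀)ᶜ
  have hexp : Integrable (fun x => Real.exp (l x)) P₀ := by
    refine ⟨by fun_prop, ?_⟩
    rw [hasFiniteIntegral_iff_ofReal (ae_of_all _ fun x => (Real.exp_pos _).le)]
    have : ∫⁻ x, ENNReal.ofReal (Real.exp (l x)) ∂P₀ = P₁ Set.univ := by
      rw [h, withDensity_apply _ MeasurableSet.univ, setLIntegral_univ]
    rw [this]; exact measure_lt_top _ _
  have e1 : P₁.real W = ∫ x in W, Real.exp (l x) ∂P₀ := by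
    rw [integral_eq_lintegral_of_nonneg_ae (ae_of_all _ fun x => (Real.exp_pos _).le)
      (by fun_prop), measureReal_def]
    conv_lhs => rw [h, withDensity_apply _ hV]
  have e0 : P₀.real W = ∫ x in W, (1 : ℝ) ∂P₀ := by simp
  rw [e1, e0, ← integral_sub (integrable_const _).integrableOn hexp.integrableOn]
  have s1 : ∫ x in W, (1 - Real.exp (l x)) ∂P₀ ≤ ∫ x in W, |l x| ∂P₀ := by
    refine integral_mono ((integrable_const _).sub hexp).integrableOn hi.abs.integrableOn ?_
    intro x
    have := Real.add_one_le_exp (l x)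
    have := neg_le_abs (l x)
    dsimp only
    linarith
  have s2 : ∫ x in W, |l x| ∂P₀ ≤ ∫ x, |l x| ∂P₀ :=
    setIntegral_le_integral hi.abs (ae_of_all _ fun x => abs_nonneg _)
  linarith

/-- Log-likelihood ratios are transported along maps with a measurable left inverse. -/
lemma map_withDensity_eq_withDensity_map {Y : Type*} [MeasurableSpace Y] {Q : Measure Y}
    {F : Y → X} {S : X → Y} (hF : Measurable F) (hS : Measurable S) (hSF : ∀ y, S (F y) = y)
    {f : Y → ENNReal} (hf : Measurable f) :
    (Q.withDensity f).map F = (Q.map F).withDensity fun x => f (S x) := by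
  ext A hA
  rw [Measure.map_apply hF hA, withDensity_apply _ (hF hA), withDensity_apply _ hA,
    setLIntegral_map (f := fun x => f (S x)) hA (by fun_prop) hF]
  simp [hSF]

end LogLikelihood

end GaussianClassification

/-! ### Log-likelihood ratios of product measures and of Gaussian measures on the line -/

namespace GaussianClassification

/-- The density of a product measure is the product of the densities of its factors. -/
lemma pi_withDensity {ι : Type*} [Fintype ι] {Ω : ι → Type*} [∀ i, MeasurableSpace (Ω i)]
    (N : ∀ i, Measure (Ω i)) [∀ i, IsProbabilityMeasure (N i)] (f : ∀ i, Ω i → ENNReal)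
    (hf : ∀ i, Measurable (f i)) [∀ i, SigmaFinite ((N i).withDensity (f i))] :
    Measure.pi (fun i => (N i).withDensity (f i)) =
      (Measure.pi N).withDensity fun x => ∏ i, f i (x i) := by
  refine Measure.pi_eq fun s hs => ?_
  have ind : iIndepFun (fun i (x : ∀ i, Ω i) => (s i).indicator (f i) (x i)) (Measure.pi N) :=
    iIndepFun_pi fun i => ((hf i).indicator (hs i)).aemeasurable
  rw [withDensity_apply _ (MeasurableSet.univ_pi hs),
    ← lintegral_indicator (MeasurableSet.univ_pi hs)]
  have e : (Set.univ.pi s).indicator (fun x : ∀ i, Ω i => ∏ i, f i (x i)) =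
      fun x => ∏ i, (s i).indicator (f i) (x i) := by
    ext x
    by_cases hx : x ∈ Set.univ.pi s
    · rw [Set.indicator_of_mem hx]
      exact Finset.prod_congr rfl fun i _ =>
        (Set.indicator_of_mem (hx i (Set.mem_univ i)) _).symm
    · rw [Set.indicator_of_notMem hx]
      simp only [Set.mem_univ_pi, not_forall] at hx
      obtain ⟨i, hi⟩ := hx
      exact (Finset.prod_eq_zero (Finset.mem_univ i) (Set.indicator_of_notMem hi _)).symm
  rw [e, lintegral_prod_eq_prod_lintegral_of_indepFun _ _ ind fun i =>
    ((hf i).indicator (hs i)).comp (measurable_pi_apply i)]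
  refine Finset.prod_congr rfl fun i _ => ?_
  rw [withDensity_apply _ (hs i), ← lintegral_indicator (hs i),
    ← (measurePreserving_eval N i).lintegral_comp ((hf i).indicator (hs i))]

lemma pi_withDensity_exp {ι : Type*} [Fintype ι] {Ω : ι → Type*} [∀ i, MeasurableSpace (Ω i)]
    (N M : ∀ i, Measure (Ω i)) [∀ i, IsProbabilityMeasure (N i)]
    [∀ i, IsProbabilityMeasure (M i)] (l : ∀ i, Ω i → ℝ) (hl : ∀ i, Measurable (l i))
    (h : ∀ i, M i = (N i).withDensity fun x => ENNReal.ofReal (Real.exp (l i x))) :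
    Measure.pi M =
      (Measure.pi N).withDensity fun x => ENNReal.ofReal (Real.exp (∑ i, l i (x i))) := by
  have : ∀ i, IsProbabilityMeasure
      ((N i).withDensity fun x => ENNReal.ofReal (Real.exp (l i x))) :=
    fun i => h i ▸ inferInstance
  rw [show M = _ from funext h, pi_withDensity _ _ fun i => by have := hl i; fun_prop]
  congr 1
  ext x
  rw [Real.exp_sum, ENNReal.ofReal_prod_of_nonneg fun _ _ => (Real.exp_pos _).le]

lemma gaussianReal_eq_withDensity {m₁ m₀ : ℝ} {w v : NNReal} (hw : w ≠ 0) (hv : v ≠ 0) :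
    gaussianReal m₁ w = (gaussianReal m₀ v).withDensity fun x => ENNReal.ofReal
      (Real.exp (Real.log (gaussianPDFReal m₁ w x) - Real.log (gaussianPDFReal m₀ v x))) := by
  rw [gaussianReal_of_var_ne_zero _ hw, gaussianReal_of_var_ne_zero _ hv,
    ← withDensity_mul₀ (by fun_prop)]
  · congr 1
    ext x
    have h1 := gaussianPDFReal_pos m₁ w x hw
    have h0 := gaussianPDFReal_pos m₀ v x hv
    rw [Pi.mul_apply, Real.exp_sub, Real.exp_log h1, Real.exp_log h0, gaussianPDF_def,
      gaussianPDF_def, ← ENNReal.ofReal_mul h0.le, mul_div_cancel₀ _ h0.ne']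
  · have := measurable_gaussianPDFReal m₁ w
    have := measurable_gaussianPDFReal m₀ v
    exact Measurable.aemeasurable (by fun_prop)

lemma log_gaussianPDFReal {m : ℝ} {v : NNReal} (hv : v ≠ 0) (x : ℝ) :
    Real.log (gaussianPDFReal m v x) =
      -(1 / 2) * Real.log (2 * Real.pi * v) - (x - m) ^ 2 / (2 * v) := by
  have hv' : (0 : ℝ) < v := by positivity
  rw [gaussianPDFReal_def, Real.log_mul (by positivity) (Real.exp_pos _).ne', Real.log_exp,
    Real.log_inv, Real.log_sqrt (by positivity)]
  ring

/-- Two Gaussian measures on the line are mutually singular or equivalent. In the second case the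
log-likelihood ratio is a quadratic polynomial in a standard Gaussian variable; its constant
coefficient is dictated by the normalization. -/
lemma gaussianReal_mutuallySingular_or (m₁ m₀ : ℝ) (w v : NNReal) :
    gaussianReal m₁ w ⟂ₘ gaussianReal m₀ v ∨
    ∃ (l : ℝ → ℝ) (a b : ℝ), Measurable l ∧
      gaussianReal m₁ w =
        (gaussianReal m₀ v).withDensity (fun x => ENNReal.ofReal (Real.exp (l x))) ∧
      a < 1 / 2 ∧
      (gaussianReal m₀ v).map l = (gaussianReal 0 1).map fun z => a * z ^ 2 + b * z +
        (Real.log (1 - 2 * a) / 2 - b ^ 2 / (2 * (1 - 2 * a))) := by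
  by_cases hw : w = 0 <;> by_cases hv : v = 0
  · subst hw; subst hv
    by_cases hm : m₁ = m₀
    · right
      subst hm
      refine ⟨fun _ => 0, 0, 0, by fun_prop, by simp, by norm_num, by simp⟩
    · left
      simp only [gaussianReal_zero_var]
      exact ⟨{m₀}, measurableSet_singleton _, by simp [hm], by simp⟩
  · left
    have := nullSingletonClass_gaussianReal (μ := m₀) hv
    exact ⟨{m₁}ᶜ, (measurableSet_singleton _).compl, by simp [hw], by simp⟩
  · left
    have := nullSingletonClass_gaussianReal (μ := m₁) hw
    exact ⟨{m₀}, measurableSet_singleton _, by simp, by simp [hv]⟩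
  · right
    have hv' : (0 : ℝ) < v := by positivity
    have hw' : (0 : ℝ) < w := by positivity
    have hs : (0 : ℝ) < Real.sqrt v := Real.sqrt_pos.2 hv'
    have hs2 : Real.sqrt v ^ 2 = v := Real.sq_sqrt hv'.le
    have hmeas : Measurable fun x =>
        Real.log (gaussianPDFReal m₁ w x) - Real.log (gaussianPDFReal m₀ v x) := by
      have := measurable_gaussianPDFReal m₁ w
      have := measurable_gaussianPDFReal m₀ v
      fun_prop
    refine ⟨_, (1 - v / w) / 2, (m₁ - m₀) * Real.sqrt v / w, hmeas,
      gaussianReal_eq_withDensity hw hv, by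
        have : 0 < (v : ℝ) / w := by positivity
        linarith, ?_⟩
    -- standardize the second measure
    have e : gaussianReal m₀ v = (gaussianReal 0 1).map fun z => m₀ + Real.sqrt v * z := by
      rw [← Function.comp_def (fun y => m₀ + y) fun z => Real.sqrt v * z,
        ← Measure.map_map (by fun_prop) (by fun_prop), gaussianReal_map_const_mul,
        gaussianReal_map_const_add]
      congr 1
      · simp
      · ext; simp [hs2]
    rw [e, Measure.map_map hmeas (by fun_prop)]
    congr 1
    ext z
    have hu : 1 - 2 * ((1 - (v : ℝ) / w) / 2) = v / w := by ring
    rw [Function.comp_apply, log_gaussianPDFReal hw, log_gaussianPDFReal hv, hu,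
      Real.log_mul (by positivity) hv'.ne', Real.log_mul (by positivity) hw'.ne',
      Real.log_div hv'.ne' hw'.ne']
    have e1 : (m₀ + Real.sqrt v * z - m₀) ^ 2 = v * z ^ 2 := by
      linear_combination z ^ 2 * hs2
    have e2 : (m₀ + Real.sqrt v * z - m₁) ^ 2 =
        v * z ^ 2 - 2 * (m₁ - m₀) * Real.sqrt v * z + (m₁ - m₀) ^ 2 := by
      linear_combination z ^ 2 * hs2
    have e3 : ((m₁ - m₀) * Real.sqrt v / w) ^ 2 = (m₁ - m₀) ^ 2 * v / w ^ 2 := by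
      rw [div_pow, mul_pow, hs2]
    rw [e1, e2, e3]
    field_simp
    ring

end GaussianClassification

/-! ### Small ball estimates from the decay of characteristic functions -/

namespace GaussianClassification

lemma gaussianReal_real_abs_le {m : ℝ} {v : NNReal} (hv : v ≠ 0) {t B : ℝ} (ht : 0 ≤ t)
    (hB : 0 ≤ B)
    (h : ∀ x, |x| ≤ t → gaussianPDFReal m v x ≤ B) :
    (gaussianReal m v).real {x | |x| ≤ t} ≤ 2 * t * B := by
  have e : {x : ℝ | |x| ≤ t} = Set.Icc (-t) t := by ext x; simp [abs_le]
  have : gaussianReal m v {x | |x| ≤ t} ≤ ENNReal.ofReal B * ENNReal.ofReal (2 * t) := by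
    rw [gaussianReal_apply _ hv, e]
    calc ∫⁻ x in Set.Icc (-t) t, gaussianPDF m v x
        ≤ ∫⁻ _ in Set.Icc (-t) t, ENNReal.ofReal B :=
          setLIntegral_mono measurable_const fun x hx =>
            ENNReal.ofReal_le_ofReal (h x (abs_le.2 hx))
      _ = _ := by rw [setLIntegral_const, Real.volume_Icc]; congr 2; ring
  rw [measureReal_def]
  refine (ENNReal.toReal_mono (by finiteness) this).trans_eq ?_
  rw [ENNReal.toReal_mul, ENNReal.toReal_ofReal hB, ENNReal.toReal_ofReal (by positivity)]
  ring

open Complex in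
/-- The characteristic function of a quadratic polynomial in a standard Gaussian variable. -/
lemma norm_integral_cexp_quadratic_pow_four_le (a b c s : ℝ) :
    ‖∫ z, cexp (s * (a * z ^ 2 + b * z + c : ℝ) * I) ∂(gaussianReal 0 1)‖ ^ 4
      ≤ 1 / (1 + 2 * s ^ 2 * (2 * a ^ 2 + b ^ 2)) := by
  have hre : ((-1 / 2 + s * a * I : ℂ)).re < 0 := by
    simp
    norm_num
  have e1 : ∫ z, cexp (s * (a * z ^ 2 + b * z + c : ℝ) * I) ∂(gaussianReal 0 1) =
      ((Real.sqrt (2 * Real.pi))⁻¹ : ℝ) *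
        ∫ z : ℝ, cexp ((-1 / 2 + s * a * I : ℂ) * z ^ 2 + (s * b * I) * z + s * c * I) := by
    rw [integral_gaussianReal_eq_integral_smul one_ne_zero, ← integral_const_mul]
    congr 1
    ext z
    rw [gaussianPDFReal_def]
    simp only [Complex.real_smul]
    push_cast
    rw [mul_assoc, ← Complex.exp_add]
    congr 2
    simp
    ring
  rw [e1, integral_cexp_quadratic hre]
  set D : ℝ := 1 + 4 * s ^ 2 * a ^ 2 with hD
  have hDpos : 0 < D := by positivity
  have n1 : ‖(-(-1 / 2 + s * a * I) : ℂ)‖ ^ 2 = D / 4 := by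
    rw [Complex.sq_norm, Complex.normSq_apply]
    simp
    ring
  have n2 : ‖((Real.pi / -(-1 / 2 + s * a * I)) ^ (1 / 2 : ℂ) : ℂ)‖ ^ 4 =
      Real.pi ^ 2 * 4 / D := by
    have : ((1 / 2 : ℂ)) = ((1 / 2 : ℝ) : ℂ) := by simp
    rw [this, Complex.norm_cpow_real]
    have : ∀ r : ℝ, 0 ≤ r → (r ^ (1 / 2 : ℝ)) ^ 4 = r ^ 2 := by
      intro r hr
      rw [← Real.sqrt_eq_rpow, show (4 : ℕ) = 2 * 2 from rfl, pow_mul, Real.sq_sqrt hr]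
    rw [this _ (norm_nonneg _), norm_div, div_pow, n1, Complex.norm_real, Real.norm_eq_abs, sq_abs]
    field_simp
  have n3 : ‖cexp (s * c * I - (s * b * I) ^ 2 / (4 * (-1 / 2 + s * a * I)))‖ ^ 4 =
      Real.exp (-(2 * s ^ 2 * b ^ 2 / D)) := by
    rw [Complex.norm_exp, ← Real.exp_nat_mul]
    congr 1
    have : ((s * b * I) ^ 2 / (4 * (-1 / 2 + s * a * I)) : ℂ) =
        ((s ^ 2 * b ^ 2 / D : ℝ) : ℂ) * (1 / 2 + s * a * I) := by
      have hne : (-1 / 2 + s * a * I : ℂ) ≠ 0 := fun h => by simp [h] at hre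
      have hne2 : (D : ℂ) ≠ 0 := by exact_mod_cast hDpos.ne'
      rw [div_eq_iff (mul_ne_zero (by norm_num) hne)]
      push_cast
      field_simp
      rw [hD]; push_cast
      ring_nf
      simp only [I_sq]
      ring
    have : (s * c * I - (s * b * I) ^ 2 / (4 * (-1 / 2 + s * a * I)) : ℂ) =
        ((-(s ^ 2 * b ^ 2 / D / 2) : ℝ) : ℂ) +
          ((s * c - s ^ 2 * b ^ 2 / D * (s * a) : ℝ) : ℂ) * I := by
      rw [this]; push_cast; ring
    rw [this, Complex.add_re, Complex.ofReal_re, Complex.re_ofReal_mul, Complex.I_re]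
    push_cast
    ring
  rw [norm_mul, norm_mul, mul_pow, mul_pow, n2, n3, Complex.norm_real, Real.norm_eq_abs,
    abs_of_pos (by positivity), inv_pow]
  have n4 : Real.sqrt (2 * Real.pi) ^ 4 = 4 * Real.pi ^ 2 := by
    rw [show (4 : ℕ) = 2 * 2 from rfl, pow_mul, Real.sq_sqrt (by positivity)]; ring
  rw [n4, Real.exp_neg]
  have h5 : 1 + 2 * s ^ 2 * b ^ 2 / D ≤ Real.exp (2 * s ^ 2 * b ^ 2 / D) := by
    linarith [Real.add_one_le_exp (2 * s ^ 2 * b ^ 2 / D)]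
  have h6 : (4 * Real.pi ^ 2)⁻¹ * (Real.pi ^ 2 * 4 / D * (Real.exp (2 * s ^ 2 * b ^ 2 / D))⁻¹) =
      1 / (D * Real.exp (2 * s ^ 2 * b ^ 2 / D)) := by
    field_simp
  rw [h6]
  apply one_div_le_one_div_of_le (by positivity)
  calc 1 + 2 * s ^ 2 * (2 * a ^ 2 + b ^ 2) = D * (1 + 2 * s ^ 2 * b ^ 2 / D) := by
        field_simp; rw [hD]; ring
    _ ≤ _ := by gcongr

open Complex in
/-- Decay of the characteristic function bounds the concentration near the origin: smooth the
indicator of `|l| ≤ η ^ 3` by a Gaussian, and write the latter as a characteristic function. -/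
lemma real_abs_le_cube_of_norm_charFun_le {X : Type*} [MeasurableSpace X] {P : Measure X}
    [IsProbabilityMeasure P] {l : X → ℝ} (hl : Measurable l) {V D : ℝ} (hV : 0 < V)
    (hD : 0 ≤ D) (hVD : 1 ≤ D ^ 4 * (2 * V))
    (h : ∀ s : ℝ, ‖∫ x, cexp (s * l x * I) ∂P‖ ^ 4 ≤ 1 / (1 + 2 * s ^ 2 * V))
    {η : ℝ} (hη : 0 < η) :
    P.real {x | |l x| ≤ η ^ 3} ≤ 2 * (1 + D) * η := by
  set τ := η ^ 3 with hτ
  have hτ0 : 0 < τ := by positivity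
  have mB : MeasurableSet {x | |l x| ≤ τ} := measurableSet_le hl.abs measurable_const
  have iexp : Integrable (fun x => Real.exp (-(l x / τ) ^ 2 / 2)) P := by
    refine Integrable.of_bound (C := 1) (by fun_prop) (ae_of_all _ fun x => ?_)
    rw [Real.norm_eq_abs, abs_of_pos (Real.exp_pos _), Real.exp_le_one_iff]
    have := sq_nonneg (l x / τ)
    linarith
  have he : Real.exp (1 / 2) ≤ 2 := by
    have := Real.exp_bound_div_one_sub_of_interval (x := 1 / 2) (by norm_num) (by norm_num)
    norm_num at this ⊢
    exact this
  have s1 : P.real {x | |l x| ≤ τ} ≤ 2 * ∫ x, Real.exp (-(l x / τ) ^ 2 / 2) ∂P := by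
    rw [← integral_indicator_one mB, ← integral_const_mul]
    refine integral_mono ((integrable_const 1).indicator mB) (iexp.const_mul 2) fun x => ?_
    by_cases hx : |l x| ≤ τ
    · rw [Set.indicator_of_mem (by exact hx)]
      have : (l x / τ) ^ 2 ≤ 1 := by
        rw [sq_le_one_iff_abs_le_one, abs_div, abs_of_pos hτ0]
        exact (div_le_one hτ0).2 hx
      have h1 : 1 ≤ Real.exp (1 / 2) * Real.exp (-(l x / τ) ^ 2 / 2) := by
        rw [← Real.exp_add]; exact Real.one_le_exp (by linarith)
      calc (1 : X → ℝ) x ≤ Real.exp (1 / 2) * Real.exp (-(l x / τ) ^ 2 / 2) := h1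
        _ ≤ _ := by gcongr
    · rw [Set.indicator_of_notMem (by exact hx)]
      positivity
  -- the Gaussian bump is the average of `exp (i s l / τ)` over a standard Gaussian `s`
  have e1 (x : X) : ((Real.exp (-(l x / τ) ^ 2 / 2) : ℝ) : ℂ) =
      ∫ s, cexp ((s / τ : ℝ) * l x * I) ∂(gaussianReal 0 1) := by
    have := charFun_gaussianReal (μ := 0) (v := 1) (l x / τ)
    rw [charFun_apply_real] at this
    rw [show (∫ s, cexp ((s / τ : ℝ) * l x * I) ∂(gaussianReal 0 1)) =
      ∫ s : ℝ, cexp ((l x / τ : ℝ) * s * I) ∂(gaussianReal 0 1) by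
        congr 1; ext s; congr 1; push_cast; ring, this]
    push_cast
    congr 1
    simp
    ring
  have s2 : ∫ x, Real.exp (-(l x / τ) ^ 2 / 2) ∂P ≤
      ∫ s, ‖∫ x, cexp ((s / τ : ℝ) * l x * I) ∂P‖ ∂(gaussianReal 0 1) := by
    have e2 : ((∫ x, Real.exp (-(l x / τ) ^ 2 / 2) ∂P : ℝ) : ℂ) =
        ∫ s, ∫ x, cexp ((s / τ : ℝ) * l x * I) ∂P ∂(gaussianReal 0 1) := by
      rw [← integral_complex_ofReal]
      simp_rw [e1]
      refine integral_integral_swap ?_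
      refine Integrable.of_bound (C := 1) ?_ (ae_of_all _ fun p => ?_)
      · have : Measurable fun p : X × ℝ => l p.1 := hl.comp measurable_fst
        apply Measurable.aestronglyMeasurable
        unfold Function.uncurry
        fun_prop
      · have : ((p.2 / τ : ℝ) * l p.1 * I : ℂ) = ((p.2 / τ * l p.1 : ℝ) : ℂ) * I := by
          push_cast; ring
        simp only [Function.uncurry]
        rw [this, Complex.norm_exp_ofReal_mul_I]
    have : ∫ x, Real.exp (-(l x / τ) ^ 2 / 2) ∂P =
        ‖((∫ x, Real.exp (-(l x / τ) ^ 2 / 2) ∂P : ℝ) : ℂ)‖ := by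
      rw [Complex.norm_real, Real.norm_eq_abs, abs_of_nonneg]
      exact integral_nonneg fun x => (Real.exp_pos _).le
    rw [this, e2]
    exact norm_integral_le_integral_norm _
  have mG : MeasurableSet {s : ℝ | |s| ≤ η} := measurableSet_le (by fun_prop) measurable_const
  -- frequencies `|s| ≤ η` are rare; at the others the characteristic function is at most `D * η`
  have hbd (s : ℝ) : ‖∫ x, cexp ((s / τ : ℝ) * l x * I) ∂P‖ ≤
      {s : ℝ | |s| ≤ η}.indicator 1 s + D * η := by
    by_cases hs : |s| ≤ η
    · rw [Set.indicator_of_mem (by exact hs)]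
      have : ‖∫ x, cexp ((s / τ : ℝ) * l x * I) ∂P‖ ≤ 1 := by
        refine (norm_integral_le_of_norm_le_const (C := 1) (ae_of_all _ fun x => ?_)).trans
          (by simp)
        have : ((s / τ : ℝ) * l x * I : ℂ) = ((s / τ * l x : ℝ) : ℂ) * I := by push_cast; ring
        rw [this, Complex.norm_exp_ofReal_mul_I]
      simp only [Pi.one_apply]
      have : 0 ≤ D * η := by positivity
      linarith
    · rw [Set.indicator_of_notMem (by exact hs), zero_add]
      refine le_of_pow_le_pow_left₀ (n := 4) (by norm_num) (by positivity) ((h _).trans ?_)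
      push Not at hs
      have h1 : η ^ 2 ≤ s ^ 2 := by
        rw [← sq_abs s]; exact pow_le_pow_left₀ hη.le hs.le 2
      have h2 : 1 / η ^ 4 ≤ (s / τ) ^ 2 := by
        rw [hτ, div_pow, div_le_div_iff₀ (by positivity) (by positivity)]
        calc 1 * (η ^ 3) ^ 2 = η ^ 2 * η ^ 4 := by ring
          _ ≤ s ^ 2 * η ^ 4 := by gcongr
      rw [div_le_iff₀ (by positivity)]
      calc 1 ≤ D ^ 4 * (2 * V) := hVD
        _ = (D * η) ^ 4 * (0 + 2 * (1 / η ^ 4) * V) := by field_simp; ring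
        _ ≤ _ := by gcongr; norm_num
  have iR : Integrable (fun s => {s : ℝ | |s| ≤ η}.indicator (1 : ℝ → ℝ) s + D * η)
      (gaussianReal 0 1) := ((integrable_const 1).indicator mG).add (integrable_const _)
  have s3 : ∫ s, ‖∫ x, cexp ((s / τ : ℝ) * l x * I) ∂P‖ ∂(gaussianReal 0 1) ≤ η + D * η := by
    refine (integral_mono_of_nonneg (ae_of_all _ fun s => norm_nonneg _) iR
      (ae_of_all _ hbd)).trans ?_
    rw [integral_add ((integrable_const 1).indicator mG) (integrable_const _),
      integral_indicator_one mG]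
    have : (gaussianReal 0 1).real {s : ℝ | |s| ≤ η} ≤ 2 * η * (1 / 2) := by
      refine gaussianReal_real_abs_le one_ne_zero hη.le (by norm_num) fun x _ => ?_
      rw [gaussianPDFReal_def]
      have h1 : (Real.sqrt (2 * Real.pi * (1 : NNReal)))⁻¹ ≤ 1 / 2 := by
        rw [one_div]
        apply inv_anti₀ (by norm_num)
        apply Real.le_sqrt_of_sq_le
        have := Real.pi_gt_three
        push_cast; linarith
      have h2 : Real.exp (-(x - 0) ^ 2 / (2 * (1 : NNReal))) ≤ 1 := by
        rw [Real.exp_le_one_iff]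
        have := sq_nonneg (x - 0)
        push_cast; linarith
      exact (mul_le_mul h1 h2 (Real.exp_pos _).le (by norm_num)).trans_eq (mul_one _)
    simp
    linarith
  calc _ ≤ 2 * (η + D * η) := by linarith
    _ = _ := by ring

end GaussianClassification

/-! ### Sums of independent normalized quadratic polynomials -/

namespace GaussianClassification

/-- The quadratic polynomial in a standard Gaussian variable which is the log-likelihood ratio of
two equivalent Gaussian measures on the line. The constant coefficient makes the expectation of its
exponential equal to one. -/
noncomputable def normalizedQuadratic (a b z : ℝ) : ℝ :=
  a * z ^ 2 + b * z + (Real.log (1 - 2 * a) / 2 - b ^ 2 / (2 * (1 - 2 * a)))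

lemma measurable_normalizedQuadratic (a b : ℝ) : Measurable (normalizedQuadratic a b) := by
  unfold normalizedQuadratic; fun_prop

lemma integrable_pow_gaussianReal (n : ℕ) (m : ℝ) (v : NNReal) :
    Integrable (fun z => z ^ n) (gaussianReal m v) := by
  have := (memLp_id_gaussianReal' (μ := m) (v := v) n (by simp)).integrable_norm_pow'
  refine (integrable_norm_iff (by fun_prop)).1 ?_
  simpa using this

lemma integral_sq_gaussianReal : ∫ z, z ^ 2 ∂(gaussianReal 0 1) = 1 := by
  have := variance_fun_id_gaussianReal (μ := 0) (v := 1)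
  rw [variance_of_integral_eq_zero (by fun_prop) integral_id_gaussianReal] at this
  simpa using this

lemma memLp_normalizedQuadratic (a b : ℝ) :
    MemLp (normalizedQuadratic a b) 2 (gaussianReal 0 1) := by
  have h1 : MemLp (fun z : ℝ => z) 2 (gaussianReal 0 1) :=
    memLp_id_gaussianReal' (μ := 0) (v := 1) 2 (by simp)
  have h2 : MemLp (fun z : ℝ => z ^ 2) 2 (gaussianReal 0 1) := by
    rw [memLp_two_iff_integrable_sq (by fun_prop)]
    simpa [← pow_mul] using integrable_pow_gaussianReal 4 0 1
  exact ((h2.const_mul a).add (h1.const_mul b)).add (memLp_const _)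

lemma integral_normalizedQuadratic (a b : ℝ) :
    ∫ z, normalizedQuadratic a b z ∂(gaussianReal 0 1) =
      a + (Real.log (1 - 2 * a) / 2 - b ^ 2 / (2 * (1 - 2 * a))) := by
  have h1 : Integrable (fun z : ℝ => b * z) (gaussianReal 0 1) := by
    simpa using (integrable_pow_gaussianReal 1 0 1).const_mul b
  have h2 := (integrable_pow_gaussianReal 2 0 1).const_mul a
  have h3 : Integrable (fun z : ℝ => a * z ^ 2 + b * z) (gaussianReal 0 1) := h2.add h1
  unfold normalizedQuadratic
  rw [integral_add h3 (integrable_const _), integral_add h2 h1, integral_const_mul,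
    integral_const_mul, integral_sq_gaussianReal, integral_id_gaussianReal]
  simp

lemma variance_normalizedQuadratic_le (a b : ℝ) :
    Var[normalizedQuadratic a b; gaussianReal 0 1] ≤
      (2 + ∫ z, z ^ 4 ∂(gaussianReal 0 1)) * (2 * a ^ 2 + b ^ 2) := by
  have h2 := integrable_pow_gaussianReal 2 0 1
  have h4 := integrable_pow_gaussianReal 4 0 1
  have p4 : 0 ≤ ∫ z, z ^ 4 ∂(gaussianReal 0 1) := integral_nonneg fun z => by positivity
  have e : Var[normalizedQuadratic a b; gaussianReal 0 1] =
      Var[fun z => a * z ^ 2 + b * z; gaussianReal 0 1] := by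
    unfold normalizedQuadratic
    exact variance_add_const (by fun_prop) _
  rw [e]
  calc Var[fun z => a * z ^ 2 + b * z; gaussianReal 0 1]
      ≤ ∫ z, (a * z ^ 2 + b * z) ^ 2 ∂(gaussianReal 0 1) := variance_le_expectation_sq (by fun_prop)
    _ ≤ ∫ z, (2 * a ^ 2 * z ^ 4 + 2 * b ^ 2 * z ^ 2) ∂(gaussianReal 0 1) := by
        refine integral_mono_of_nonneg (ae_of_all _ fun z => sq_nonneg _)
          ((h4.const_mul _).add (h2.const_mul _)) (ae_of_all _ fun z => ?_)
        have := sq_nonneg (a * z ^ 2 - b * z)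
        dsimp only
        nlinarith
    _ = 2 * a ^ 2 * (∫ z, z ^ 4 ∂(gaussianReal 0 1)) + 2 * b ^ 2 := by
        rw [integral_add (h4.const_mul _) (h2.const_mul _), integral_const_mul,
          integral_const_mul, integral_sq_gaussianReal, mul_one]
    _ ≤ _ := by nlinarith [mul_nonneg p4 (sq_nonneg b), sq_nonneg a]

lemma abs_integral_normalizedQuadratic_le {a : ℝ} (b : ℝ) (ha : |a| ≤ 1 / 4) :
    |∫ z, normalizedQuadratic a b z ∂(gaussianReal 0 1)| ≤ 2 * (2 * a ^ 2 + b ^ 2) := by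
  rw [integral_normalizedQuadratic]
  obtain ⟨h1, h2⟩ := abs_le.1 ha
  have hu : 1 / 2 ≤ 1 - 2 * a := by linarith
  have hu0 : 0 < 1 - 2 * a := by linarith
  have l1 := Real.log_le_sub_one_of_pos hu0
  have l2 := Real.one_sub_inv_le_log_of_pos hu0
  have l3 : -(4 * a ^ 2) ≤ a + (1 - (1 - 2 * a)⁻¹) / 2 := by
    have : a + (1 - (1 - 2 * a)⁻¹) / 2 = -(2 * a ^ 2 / (1 - 2 * a)) := by
      have e := mul_inv_cancel₀ hu0.ne'
      rw [div_eq_mul_inv (2 * a ^ 2)]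
      linear_combination -(1 / 2 + a) * e
    rw [this, neg_le_neg_iff, div_le_iff₀ hu0]
    nlinarith [sq_nonneg a]
  have l4 : b ^ 2 / (2 * (1 - 2 * a)) ≤ b ^ 2 := by
    rw [div_le_iff₀ (by linarith)]
    nlinarith [sq_nonneg b]
  have l5 : 0 ≤ b ^ 2 / (2 * (1 - 2 * a)) := by positivity
  rw [abs_le]
  constructor <;> nlinarith [sq_nonneg b, sq_nonneg a]

section Product

variable {ι : Type*} [Fintype ι] {N : ι → Measure ℝ} [∀ i, IsProbabilityMeasure (N i)]
  {l : ι → ℝ → ℝ} {a b : ι → ℝ}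

open Complex in
/-- A product of characteristic functions, each bounded by `(1 + 2 s² vᵢ) ^ (-1/4)`, is bounded by
`(1 + 2 s² ∑ vᵢ) ^ (-1/4)`: this is where the estimate becomes independent of the dimension. -/
lemma norm_charFun_sum_pow_four_le
    (h : ∀ i, IdentDistrib (l i) (normalizedQuadratic (a i) (b i)) (N i) (gaussianReal 0 1))
    (s : ℝ) :
    ‖∫ x, cexp (s * (∑ i, l i (x i) : ℝ) * I) ∂(Measure.pi N)‖ ^ 4 ≤
      1 / (1 + 2 * s ^ 2 * ∑ i, (2 * a i ^ 2 + b i ^ 2)) := by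
  have e : ∫ x, cexp (s * (∑ i, l i (x i) : ℝ) * I) ∂(Measure.pi N) =
      ∏ i, ∫ z, cexp (s * (normalizedQuadratic (a i) (b i) z : ℝ) * I) ∂(gaussianReal 0 1) := by
    have : ∀ x : ι → ℝ, cexp (s * (∑ i, l i (x i) : ℝ) * I) =
        ∏ i, cexp (s * (l i (x i) : ℝ) * I) := by
      intro x
      rw [← Complex.exp_sum]
      push_cast
      rw [Finset.mul_sum, Finset.sum_mul]
    simp_rw [this]
    rw [integral_fintype_prod_eq_prod (f := fun i y => cexp (s * (l i y : ℝ) * I))]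
    refine Finset.prod_congr rfl fun i _ => ?_
    exact ((h i).comp (u := fun y : ℝ => cexp (s * y * I)) (by fun_prop)).integral_eq
  have prod_le (t : Finset ι) : ∏ i ∈ t, ‖∫ z, cexp
      (s * (normalizedQuadratic (a i) (b i) z : ℝ) * I) ∂(gaussianReal 0 1)‖ ^ 4 ≤
      1 / (1 + 2 * s ^ 2 * ∑ i ∈ t, (2 * a i ^ 2 + b i ^ 2)) := by
    classical
    induction t using Finset.induction_on with
    | empty => simp
    | insert i t hi ih =>
      rw [Finset.prod_insert hi, Finset.sum_insert hi]
      have p : 0 ≤ ∑ i ∈ t, (2 * a i ^ 2 + b i ^ 2) := Finset.sum_nonneg fun i _ => by positivity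
      refine (mul_le_mul (norm_integral_cexp_quadratic_pow_four_le _ _ _ s) ih
        (Finset.prod_nonneg fun i _ => by positivity) (by positivity)).trans ?_
      rw [one_div_mul_one_div]
      apply one_div_le_one_div_of_le (by positivity)
      have : 0 ≤ (2 * s ^ 2 * (2 * a i ^ 2 + b i ^ 2)) *
        (2 * s ^ 2 * ∑ i ∈ t, (2 * a i ^ 2 + b i ^ 2)) := by positivity
      linarith
  rw [e, norm_prod, ← Finset.prod_pow]
  exact prod_le Finset.univ

lemma memLp_sum_pi
    (h : ∀ i, IdentDistrib (l i) (normalizedQuadratic (a i) (b i)) (N i) (gaussianReal 0 1)) :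
    MemLp (fun x : ι → ℝ => ∑ i, l i (x i)) 2 (Measure.pi N) :=
  memLp_finsetSum _ fun i _ => ((h i).memLp_iff.2
    (memLp_normalizedQuadratic _ _)).comp_measurePreserving (measurePreserving_eval N i)

/-- The first moment of the log-likelihood ratio is controlled by `∑ (2 aᵢ² + bᵢ²)` when this
quantity is small. -/
lemma integral_abs_sum_le
    (h : ∀ i, IdentDistrib (l i) (normalizedQuadratic (a i) (b i)) (N i) (gaussianReal 0 1))
    (hV : ∑ i, (2 * a i ^ 2 + b i ^ 2) ≤ 1 / 8) :
    ∫ x, |∑ i, l i (x i)| ∂(Measure.pi N) ≤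
      Real.sqrt ((2 + ∫ z, z ^ 4 ∂(gaussianReal 0 1)) * ∑ i, (2 * a i ^ 2 + b i ^ 2)) +
        2 * ∑ i, (2 * a i ^ 2 + b i ^ 2) := by
  set f : (ι → ℝ) → ℝ := fun x => ∑ i, l i (x i) with hf
  have hL := memLp_sum_pi h
  have hi : Integrable f (Measure.pi N) := hL.integrable (by norm_num)
  have hli (i : ι) : MemLp (l i) 2 (N i) := (h i).memLp_iff.2 (memLp_normalizedQuadratic _ _)
  have hmean : |∫ x, f x ∂(Measure.pi N)| ≤ 2 * ∑ i, (2 * a i ^ 2 + b i ^ 2) := by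
    have : ∫ x, f x ∂(Measure.pi N) =
        ∑ i, ∫ z, normalizedQuadratic (a i) (b i) z ∂(gaussianReal 0 1) := by
      rw [hf, integral_finsetSum]
      · refine Finset.sum_congr rfl fun i _ => ?_
        rw [integral_comp_eval (μ := N) (i := i) (f := l i) (hli i).1, (h i).integral_eq]
      · exact fun i _ => integrable_comp_eval (i := i) ((hli i).integrable (by norm_num))
    rw [this, Finset.mul_sum]
    refine (Finset.abs_sum_le_sum_abs _ _).trans (Finset.sum_le_sum fun i _ => ?_)
    apply abs_integral_normalizedQuadratic_le
    have : 2 * a i ^ 2 + b i ^ 2 ≤ 1 / 8 :=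
      (Finset.single_le_sum (f := fun i => 2 * a i ^ 2 + b i ^ 2)
        (fun i _ => by positivity) (Finset.mem_univ i)).trans hV
    exact abs_le_of_sq_le_sq (by nlinarith [sq_nonneg (b i)]) (by norm_num)
  have hvar : Var[f; Measure.pi N] ≤
      (2 + ∫ z, z ^ 4 ∂(gaussianReal 0 1)) * ∑ i, (2 * a i ^ 2 + b i ^ 2) := by
    have e : f = ∑ i, fun x : ι → ℝ => l i (x i) := by ext x; simp [hf]
    rw [e, variance_sum_pi hli, Finset.mul_sum]
    refine Finset.sum_le_sum fun i _ => ?_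
    rw [(h i).variance_eq]
    exact variance_normalizedQuadratic_le _ _
  set m := ∫ x, f x ∂(Measure.pi N)
  have him : Integrable (fun x => |f x - m|) (Measure.pi N) := (hi.sub (integrable_const m)).abs
  have hdev : ∫ x, |f x - m| ∂(Measure.pi N) ≤ Real.sqrt (Var[f; Measure.pi N]) := by
    apply Real.le_sqrt_of_sq_le
    have hg : MemLp (fun x => |f x - m|) 2 (Measure.pi N) := (hL.sub (memLp_const m)).abs
    have := variance_nonneg (fun x => |f x - m|) (Measure.pi N)
    rw [variance_eq_sub hg] at this
    rw [variance_eq_integral hL.1.aemeasurable]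
    simp only [Pi.pow_apply, sq_abs] at this
    linarith
  have hsplit : ∫ x, |f x| ∂(Measure.pi N) ≤ ∫ x, (|f x - m| + |m|) ∂(Measure.pi N) := by
    refine integral_mono hi.abs (him.add (integrable_const _)) ?_
    intro x
    have := abs_add_le (f x - m) m
    simpa using this
  rw [integral_add him (integrable_const _)] at hsplit
  simp only [integral_const, probReal_univ, one_smul] at hsplit
  have := Real.sqrt_le_sqrt hvar
  linarith

end Product

end GaussianClassification

/-! ### The dimension-free bound for products of Gaussian measures on the line -/

namespace GaussianClassification

variable {X : Type*} [MeasurableSpace X]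

open Complex in
/-- The quantitative excess risk bound when the characteristic function of the log-likelihood ratio
decays at a rate governed by `V ≥ V₀`. -/
lemma mul_pow_eight_le_excessRisk {P₁ P₀ : Measure X} [IsProbabilityMeasure P₁]
    [IsProbabilityMeasure P₀] {l : X → ℝ} (hl : Measurable l)
    (h : P₁ = P₀.withDensity fun x => ENNReal.ofReal (Real.exp (l x)))
    {V V₀ : ℝ} (hV₀ : 0 < V₀) (hV : V₀ ≤ V)
    (hchar : ∀ s : ℝ, ‖∫ x, cexp (s * l x * I) ∂P₀‖ ^ 4 ≤ 1 / (1 + 2 * s ^ 2 * V))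
    {g : X → Fin 2} (hg : Measurable g) :
    1 / (864 * (2 + 1 / (2 * V₀)) ^ 3) * learningError P₁ P₀ g ^ 8 ≤ excessRisk P₁ P₀ g := by
  have hR0 := learningError_nonneg P₁ P₀ g
  have hR1 := learningError_le_one P₁ P₀ g
  set R := learningError P₁ P₀ g with hR
  rcases hR0.eq_or_lt with h0 | h0
  · rw [← h0]
    simpa using excessRisk_nonneg P₁ P₀ hg
  set D := 1 + 1 / (2 * V₀) with hD
  have hq : 0 < 1 / (2 * V₀) := by positivity
  have hD1 : 1 ≤ D := by linarith
  have hVD : 1 ≤ D ^ 4 * (2 * V) := by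
    -- only a power of `D` enters, which avoids fractional powers of `V₀`
    have h4 : D ≤ D ^ 4 := le_self_pow₀ hD1 (by norm_num)
    calc 1 = 1 / (2 * V₀) * (2 * V₀) := by field_simp
      _ ≤ D ^ 4 * (2 * V) := by gcongr; linarith
  set A := 2 * (1 + D) with hA
  have hA2 : 2 ≤ A := by linarith
  -- this choice makes the discarded mass at most half of the learning error
  set η := R / (3 * A) with hη
  have hη0 : 0 < η := by positivity
  have hη1 : η ≤ 1 / 6 := by
    rw [hη, div_le_iff₀ (by positivity)]
    linarith
  have key := mul_sub_le_excessRisk hl h hg (ε := η ^ 3 / 2) (by positivity) (by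
    have : η ^ 3 ≤ (1 / 6) ^ 3 := by gcongr
    linarith)
  have hball := real_abs_le_cube_of_norm_charFun_le hl (hV₀.trans_le hV) (by linarith) hVD hchar hη0
  rw [mul_div_cancel₀ _ (two_ne_zero' ℝ), ← hR] at key
  have hAη : A * η = R / 3 := by rw [hη]; field_simp
  have hmid : R / 2 ≤ R - 3 / 2 * P₀.real {x | |l x| ≤ η ^ 3} := by linarith
  calc 1 / (864 * (2 + 1 / (2 * V₀)) ^ 3) * R ^ 8
      ≤ 1 / (864 * (2 + 1 / (2 * V₀)) ^ 3) * R ^ 4 := by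
        gcongr ?_ * ?_
        exact pow_le_pow_of_le_one h0.le hR1 (by norm_num)
    _ = η ^ 3 / 2 * (R / 2) := by
        have : A = 2 * (2 + 1 / (2 * V₀)) := by rw [hA, hD]; ring
        rw [hη, this]
        generalize 2 + 1 / (2 * V₀) = B at *
        have hB : B ≠ 0 := by rintro rfl; linarith
        field_simp
        norm_num
    _ ≤ η ^ 3 / 2 * (R - 3 / 2 * P₀.real {x | |l x| ≤ η ^ 3}) := by gcongr
    _ ≤ _ := key

lemma mutuallySingular_map_pi {ι : Type*} [Fintype ι] {N M : ι → Measure ℝ}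
    [∀ i, IsProbabilityMeasure (N i)] [∀ i, IsProbabilityMeasure (M i)] {F : (ι → ℝ) → X}
    {S : X → ι → ℝ} (hF : Measurable F) (hS : Measurable S) (hSF : ∀ y, S (F y) = y) {i : ι}
    (hi : M i ⟂ₘ N i) : (Measure.pi M).map F ⟂ₘ (Measure.pi N).map F := by
  obtain ⟨B, hB, h1, h0⟩ := hi
  have hm : Measurable fun x => S x i := (measurable_pi_apply i).comp hS
  have aux (Q : ι → Measure ℝ) [∀ i, IsProbabilityMeasure (Q i)] {B : Set ℝ}
      (hB : MeasurableSet B) : (Measure.pi Q).map F {x | S x i ∈ B} = Q i B := by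
    change (Measure.pi Q).map F ((fun x => S x i) ⁻¹' B) = _
    rw [Measure.map_apply hF (hm hB), ← (measurePreserving_eval Q i).measure_preimage
      hB.nullMeasurableSet]
    congr 1
    ext y
    simp [hSF]
  exact ⟨{x | S x i ∈ B}, hm hB, by rw [aux M hB, h1], by
    rw [show {x | S x i ∈ B}ᶜ = {x | S x i ∈ Bᶜ} from rfl, aux N hB.compl, h0]⟩

/-- The dimension-free bound for images of products of Gaussian measures on the line. -/
lemma exists_mul_pow_eight_le_excessRisk {c₁ : ℝ} (hc₁ : 0 < c₁) :
    ∃ c : ℝ, 0 < c ∧ ∀ (ι X : Type) [Fintype ι] [MeasurableSpace X] (m₁ m₀ : ι → ℝ)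
      (w v : ι → NNReal) (F : (ι → ℝ) → X) (S : X → ι → ℝ), Measurable F → Measurable S →
      (∀ y, S (F y) = y) → ∀ P₁ P₀ : Measure X,
      P₁ = (Measure.pi fun i => gaussianReal (m₁ i) (w i)).map F →
      P₀ = (Measure.pi fun i => gaussianReal (m₀ i) (v i)).map F →
      c₁ < l1Dist P₁ P₀ → ∀ g : X → Fin 2, Measurable g →
        min (c * learningError P₁ P₀ g ^ 8) (learningError P₁ P₀ g / 8) ≤ excessRisk P₁ P₀ g := by
  set K := 2 + ∫ z, z ^ 4 ∂(gaussianReal 0 1) with hK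
  have hK0 : 0 < K := by
    have : 0 ≤ ∫ z, z ^ 4 ∂(gaussianReal 0 1) := integral_nonneg fun z => by positivity
    linarith
  -- below this variance parameter the two measures are closer than `c₁`
  set V₀ := min (1 / 8) (min (c₁ / 8) (c₁ ^ 2 / (16 * K))) with hV₀
  have hV₀0 : 0 < V₀ := by positivity
  refine ⟨1 / (864 * (2 + 1 / (2 * V₀)) ^ 3), by positivity, ?_⟩
  intro ι X _ _ m₁ m₀ w v F S hF hS hSF P₁ P₀ e1 e0 hd g hg
  have : IsProbabilityMeasure P₁ := e1 ▸ Measure.isProbabilityMeasure_map hF.aemeasurable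
  have : IsProbabilityMeasure P₀ := e0 ▸ Measure.isProbabilityMeasure_map hF.aemeasurable
  by_cases hs : ∃ i, gaussianReal (m₁ i) (w i) ⟂ₘ gaussianReal (m₀ i) (v i)
  · obtain ⟨i, hi⟩ := hs
    have hP : P₁ ⟂ₘ P₀ := by
      rw [e1, e0]
      exact mutuallySingular_map_pi (M := fun i => gaussianReal (m₁ i) (w i))
        (N := fun i => gaussianReal (m₀ i) (v i)) hF hS hSF hi
    rw [excessRisk_eq_learningError_of_mutuallySingular P₁ P₀ hP hg]
    have := learningError_nonneg P₁ P₀ g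
    exact (min_le_right _ _).trans (by linarith)
  · push Not at hs
    have hex := fun i => (gaussianReal_mutuallySingular_or (m₁ i) (m₀ i) (w i) (v i)).resolve_left
      (hs i)
    choose l a b hl hden ha hlaw using hex
    set N : ι → Measure ℝ := fun i => gaussianReal (m₀ i) (v i) with hN
    have hid : ∀ i, IdentDistrib (l i) (normalizedQuadratic (a i) (b i)) (N i) (gaussianReal 0 1) :=
      fun i => ⟨(hl i).aemeasurable, (measurable_normalizedQuadratic _ _).aemeasurable, hlaw i⟩
    have hsum : Measurable fun y : ι → ℝ => ∑ i, l i (y i) := by fun_prop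
    have hL : Measurable fun x => ∑ i, l i (S x i) := hsum.comp hS
    have hPd : P₁ = P₀.withDensity fun x => ENNReal.ofReal (Real.exp (∑ i, l i (S x i))) := by
      rw [e1, pi_withDensity_exp N (fun i => gaussianReal (m₁ i) (w i)) l hl hden,
        map_withDensity_eq_withDensity_map hF hS hSF (by fun_prop), e0]
    have hchar (s : ℝ) : ‖∫ x, Complex.exp (s * (∑ i, l i (S x i) : ℝ) * Complex.I) ∂P₀‖ ^ 4 ≤
        1 / (1 + 2 * s ^ 2 * ∑ i, (2 * a i ^ 2 + b i ^ 2)) := by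
      rw [e0, integral_map hF.aemeasurable (Measurable.aestronglyMeasurable (by fun_prop))]
      simp only [hSF]
      exact norm_charFun_sum_pow_four_le hid s
    refine (min_le_left _ _).trans (mul_pow_eight_le_excessRisk hL hPd hV₀0 ?_ hchar hg)
    by_contra! hlt
    set V := ∑ i, (2 * a i ^ 2 + b i ^ 2) with hV
    have v1 : V ≤ 1 / 8 := hlt.le.trans (min_le_left _ _)
    have v2 : V ≤ c₁ / 8 := hlt.le.trans ((min_le_right _ _).trans (min_le_left _ _))
    have v3 : V ≤ c₁ ^ 2 / (16 * K) := hlt.le.trans ((min_le_right _ _).trans (min_le_right _ _))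
    have hint : Integrable (fun x => ∑ i, l i (S x i)) P₀ := by
      rw [e0, integrable_map_measure hL.aestronglyMeasurable hF.aemeasurable]
      simpa [Function.comp_def, hSF] using (memLp_sum_pi hid).integrable (by norm_num)
    have b1 := l1Dist_le hL hPd hint
    have b2 : ∫ x, |∑ i, l i (S x i)| ∂P₀ = ∫ y, |∑ i, l i (y i)| ∂(Measure.pi N) := by
      rw [e0, integral_map hF.aemeasurable (Measurable.aestronglyMeasurable (by fun_prop))]
      simp only [hSF]
    have b3 := integral_abs_sum_le hid v1
    have b4 : Real.sqrt (K * V) ≤ c₁ / 4 := by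
      rw [Real.sqrt_le_left (by positivity)]
      calc K * V ≤ K * (c₁ ^ 2 / (16 * K)) := by gcongr
        _ = (c₁ / 4) ^ 2 := by field_simp; norm_num
    linarith

end GaussianClassification

/-! ### Simultaneous diagonalization of two positive semidefinite matrices -/

namespace GaussianClassification

open Matrix

/-- A diagonal entry of a positive semidefinite matrix vanishes only together with its row. -/
lemma posSemidef_apply_eq_zero_of_diag {n : Type*} [Fintype n] [DecidableEq n]
    {A : Matrix n n ℝ} (hA : A.PosSemidef) {i : n} (hi : A i i = 0) (j : n) : A i j = 0 := by
  have h := hA.dotProduct_mulVec_zero_iff (Pi.single i 1)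
  have h2 : A *ᵥ Pi.single i 1 = 0 := by
    rw [← h]
    simp [hi]
  have h3 := congrFun h2 j
  have h4 := hA.isHermitian.apply i j
  simp only [star_trivial] at h4
  rw [← h4]
  simpa using h3

lemma exists_mul_diagonal_mul_transpose {n : Type*} [Fintype n] [DecidableEq n]
    {A : Matrix n n ℝ} (hA : A.IsHermitian) :
    ∃ (O : Matrix n n ℝ) (d : n → ℝ), O * Oᵀ = 1 ∧ Oᵀ * O = 1 ∧ O * A * Oᵀ = diagonal d := by
  set U : Matrix n n ℝ := (hA.eigenvectorUnitary : Matrix n n ℝ) with hU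
  have h1 : star U * U = 1 := Unitary.coe_star_mul_self hA.eigenvectorUnitary
  have h2 : U * star U = 1 := Unitary.coe_mul_star_self hA.eigenvectorUnitary
  have hst : star U = Uᵀ := by rw [star_eq_conjTranspose, conjTranspose_eq_transpose_of_trivial]
  rw [hst] at h1 h2
  refine ⟨Uᵀ, hA.eigenvalues, by simpa using h1, by simpa using h2, ?_⟩
  have h3 : A = U * diagonal hA.eigenvalues * Uᵀ := by
    have := hA.spectral_theorem
    rw [Unitary.conjStarAlgAut_apply] at this
    simpa [hst, ← hU, Function.comp_def] using this
  rw [transpose_transpose]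
  calc Uᵀ * A * U = Uᵀ * (U * diagonal hA.eigenvalues * Uᵀ) * U := by rw [← h3]
    _ = (Uᵀ * U) * diagonal hA.eigenvalues * (Uᵀ * U) := by simp only [Matrix.mul_assoc]
    _ = _ := by rw [h1]; simp

/-- Two positive semidefinite matrices are diagonalized by a common congruence. Normalizing the sum
to a coordinate projection `E`, the two matrices commute; a spectral decomposition of the first one
minus `1 - E` then separates the kernel of the sum, which gets the eigenvalue `-1`, from its
range. -/
lemma exists_simultaneous_diagonalization {n : Type*} [Fintype n] [DecidableEq n]
    {A B : Matrix n n ℝ} (hA : A.PosSemidef) (hB : B.PosSemidef) :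
    ∃ T T' : Matrix n n ℝ, T * T' = 1 ∧ T' * T = 1 ∧ (T * A * Tᵀ).IsDiag ∧
      (T * B * Tᵀ).IsDiag := by
  obtain ⟨U, s, hU1, hU2, hS⟩ := exists_mul_diagonal_mul_transpose (hA.add hB).isHermitian
  have hs : ∀ i, 0 ≤ s i := by
    intro i
    have := ((hA.add hB).mul_mul_conjTranspose_same U).diag_nonneg (i := i)
    rw [conjTranspose_eq_transpose_of_trivial, hS] at this
    simpa using this
  -- after scaling by `d`, the sum becomes the coordinate projection `diagonal e`
  set d : n → ℝ := fun i => if s i = 0 then 1 else (Real.sqrt (s i))⁻¹ with hd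
  have hd0 : ∀ i, d i ≠ 0 := by
    intro i
    simp only [hd]
    split_ifs with h
    · exact one_ne_zero
    · exact inv_ne_zero (Real.sqrt_ne_zero'.2 ((hs i).lt_of_ne' h))
  set e : n → ℝ := fun i => if s i = 0 then 0 else 1 with he
  have hde : ∀ i, d i * s i * d i = e i := by
    intro i
    simp only [hd, he]
    split_ifs with h
    · simp [h]
    · have h1 := Real.sqrt_ne_zero'.2 ((hs i).lt_of_ne' h)
      have h2 := Real.sq_sqrt (hs i)
      field_simp
      exact h2.symm
  set R := diagonal d * U with hR
  set a := R * A * Rᵀ with ha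
  set b := R * B * Rᵀ with hb
  have hab : a + b = diagonal e := by
    have : a + b = diagonal d * (U * (A + B) * Uᵀ) * diagonal d := by
      rw [ha, hb, hR, transpose_mul, diagonal_transpose]
      simp only [Matrix.mul_assoc, Matrix.mul_add, Matrix.add_mul]
    rw [this, hS, diagonal_mul_diagonal, diagonal_mul_diagonal]
    congr 1
    exact funext hde
  have ha0 : a.PosSemidef := by
    have := hA.mul_mul_conjTranspose_same R
    rwa [conjTranspose_eq_transpose_of_trivial] at this
  have hb0 : b.PosSemidef := by
    have := hB.mul_mul_conjTranspose_same R
    rwa [conjTranspose_eq_transpose_of_trivial] at this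
  set P : Matrix n n ℝ := diagonal fun i => 1 - e i with hP
  have hPa : P * a = 0 := by
    ext i j
    rw [hP, diagonal_mul, Matrix.zero_apply]
    by_cases h : s i = 0
    · have h1 : a i i + b i i = 0 := by
        have := congrFun (congrFun hab i) i
        simpa [he, h] using this
      have h2 := ha0.diag_nonneg (i := i)
      have h3 := hb0.diag_nonneg (i := i)
      rw [posSemidef_apply_eq_zero_of_diag ha0 (by linarith) j, mul_zero]
    · simp [he, h]
  have hPP : P * P = P := by
    rw [hP, diagonal_mul_diagonal]
    congr 1
    ext i
    by_cases h : s i = 0 <;> simp [he, h]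
  obtain ⟨O, D, hO1, hO2, hO⟩ := exists_mul_diagonal_mul_transpose (A := a - P)
    (ha0.isHermitian.sub (isHermitian_diagonal _))
  set a' := O * a * Oᵀ with ha'
  set p := O * P * Oᵀ with hp
  have e1 : a' - p = diagonal D := by
    rw [← hO, ha', hp, Matrix.mul_sub, Matrix.sub_mul]
  have conj_mul (M M' : Matrix n n ℝ) : (O * M * Oᵀ) * (O * M' * Oᵀ) = O * (M * M') * Oᵀ := by
    calc (O * M * Oᵀ) * (O * M' * Oᵀ) = O * M * (Oᵀ * O) * M' * Oᵀ := by
          simp only [Matrix.mul_assoc]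
      _ = _ := by rw [hO2]; simp only [Matrix.mul_assoc, Matrix.mul_one]
  have hpa : p * a' = 0 := by rw [hp, ha', conj_mul, hPa]; simp
  have hpp : p * p = p := by rw [hp, conj_mul, hPP]
  have ha'0 : a'.PosSemidef := by
    have := ha0.mul_mul_conjTranspose_same O
    rwa [conjTranspose_eq_transpose_of_trivial] at this
  -- a nonzero entry of `p` forces the eigenvalue `-1`, for which `a'` has no entries in that row
  have hdiag : p.IsDiag := by
    intro i j hij
    by_contra hne
    have f1 : p * diagonal D = -p := by rw [← e1, Matrix.mul_sub, hpa, hpp, zero_sub]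
    have f2 : D j = -1 := by
      have := congrFun (congrFun f1 i) j
      rw [mul_diagonal, Matrix.neg_apply] at this
      have : p i j * (D j + 1) = 0 := by linarith
      have := (mul_eq_zero.1 this).resolve_left hne
      linarith
    have f3 : diagonal D * a' = a' * a' := by rw [← e1, Matrix.sub_mul, hpa, sub_zero]
    have f4 : D j * a' j j = ∑ k, a' j k ^ 2 := by
      have := congrFun (congrFun f3 j) j
      rw [diagonal_mul, Matrix.mul_apply] at this
      rw [this]
      refine Finset.sum_congr rfl fun k _ => ?_
      have := ha'0.isHermitian.apply j k
      simp only [star_trivial] at this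
      rw [this]; ring
    have f5 : a' j j = 0 := by
      have h1 := ha'0.diag_nonneg (i := j)
      have h2 : 0 ≤ ∑ k, a' j k ^ 2 := Finset.sum_nonneg fun k _ => sq_nonneg _
      rw [f2] at f4
      linarith
    have f6 := posSemidef_apply_eq_zero_of_diag ha'0 f5 i
    have f7 := ha'0.isHermitian.apply i j
    simp only [star_trivial] at f7
    have f8 := congrFun (congrFun e1 i) j
    rw [diagonal_apply_ne _ hij, Matrix.sub_apply, ← f7, f6] at f8
    exact hne (by linarith)
  have ea : O * R * A * (O * R)ᵀ = a' := by
    rw [ha', ha, transpose_mul]; simp only [Matrix.mul_assoc]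
  have eb : O * R * B * (O * R)ᵀ = 1 - p - a' := by
    have : b = (1 - P) - a := by
      have : (1 : Matrix n n ℝ) - P = diagonal e := by
        rw [hP, ← diagonal_one, diagonal_sub]; congr 1; ext i; ring
      rw [this, ← hab]; abel
    have h2 : O * R * B * (O * R)ᵀ = O * b * Oᵀ := by
      rw [hb, transpose_mul]; simp only [Matrix.mul_assoc]
    rw [h2, this, ha', hp, Matrix.mul_sub, Matrix.mul_sub, Matrix.sub_mul, Matrix.sub_mul,
      Matrix.mul_one, hO1]
  have ha'd : a'.IsDiag := by
    rw [show a' = diagonal D + p by rw [← e1]; abel]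
    exact (isDiag_diagonal D).add hdiag
  have hdd : diagonal (fun i => (d i)⁻¹) * diagonal d = 1 := by
    rw [diagonal_mul_diagonal, ← diagonal_one]
    congr 1; ext i; exact inv_mul_cancel₀ (hd0 i)
  have hTT : (Uᵀ * diagonal (fun i => (d i)⁻¹) * Oᵀ) * (O * R) = 1 := by
    calc (Uᵀ * diagonal (fun i => (d i)⁻¹) * Oᵀ) * (O * R)
        = Uᵀ * (diagonal (fun i => (d i)⁻¹) * ((Oᵀ * O) * diagonal d)) * U := by
          rw [hR]; simp only [Matrix.mul_assoc]
      _ = 1 := by rw [hO2, Matrix.one_mul, hdd, Matrix.mul_one, hU2]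
  exact ⟨O * R, _, mul_eq_one_comm.1 hTT, hTT, ea ▸ ha'd,
    eb ▸ ((isDiag_one.sub hdiag).sub ha'd)⟩

end GaussianClassification

/-! ### Gaussian classes on Euclidean space -/

namespace GaussianClassification

open Matrix

section Diagonalization

variable {n : Type*} [Fintype n]

/-- The covariance matrix of the coordinates. -/
noncomputable def covarianceMatrix (P : Measure (EuclideanSpace ℝ n)) : Matrix n n ℝ :=
  fun i j => cov[fun x => x i, fun x => x j; P]

lemma covariance_dotProduct (P : Measure (EuclideanSpace ℝ n)) [IsGaussian P] (u w : n → ℝ) :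
    cov[fun x => u ⬝ᵥ x.ofLp, fun x => w ⬝ᵥ x.ofLp; P] = u ⬝ᵥ (covarianceMatrix P *ᵥ w) := by
  have hX (i : n) : MemLp (fun x : EuclideanSpace ℝ n => x i) 2 P :=
    IsGaussian.memLp_dual P (EuclideanSpace.proj i) 2 (by simp)
  have hX' (u : n → ℝ) (i : n) : MemLp (fun x : EuclideanSpace ℝ n => u i * x i) 2 P :=
    (hX i).const_mul _
  simp only [dotProduct, mulVec]
  rw [covariance_fun_sum_left (hX' u) (memLp_finsetSum _ fun i _ => hX' w i)]
  refine Finset.sum_congr rfl fun i _ => ?_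
  rw [covariance_const_mul_left, covariance_fun_sum_right (hX' w) (hX i)]
  congr 1
  refine Finset.sum_congr rfl fun j _ => ?_
  rw [covariance_const_mul_right, covarianceMatrix, mul_comm]

lemma posSemidef_covarianceMatrix (P : Measure (EuclideanSpace ℝ n)) [IsGaussian P] :
    (covarianceMatrix P).PosSemidef := by
  refine PosSemidef.of_dotProduct_mulVec_nonneg ?_ fun u => ?_
  · ext i j
    simp only [conjTranspose_apply, star_trivial, covarianceMatrix]
    exact covariance_comm _ _
  · rw [star_trivial, ← covariance_dotProduct, covariance_self (by fun_prop)]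
    exact variance_nonneg _ _

/-- A linear map diagonalizing the covariance turns a Gaussian measure into a product of Gaussian
measures on the line, possibly degenerate. -/
lemma exists_map_mulVec_eq_pi [DecidableEq n] (P : Measure (EuclideanSpace ℝ n)) [IsGaussian P]
    {T : Matrix n n ℝ} (hT : (T * covarianceMatrix P * Tᵀ).IsDiag) :
    ∃ (m : n → ℝ) (v : n → NNReal),
      P.map (fun x => T *ᵥ x.ofLp) = Measure.pi fun i => gaussianReal (m i) (v i) := by
  let L : EuclideanSpace ℝ n →L[ℝ] (n → ℝ) :=
    (LinearMap.toContinuousLinearMap T.mulVecLin).comp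
      (EuclideanSpace.equiv n ℝ).toContinuousLinearMap
  have hL : HasGaussianLaw (fun x : EuclideanSpace ℝ n => T *ᵥ x.ofLp) P :=
    (IsGaussian.hasGaussianLaw_id (μ := P)).map_fun L
  have hi (i : n) : HasGaussianLaw (fun x : EuclideanSpace ℝ n => (T *ᵥ x.ofLp) i) P := hL.eval i
  have hind : iIndepFun (fun i (x : EuclideanSpace ℝ n) => (T *ᵥ x.ofLp) i) P := by
    refine hL.iIndepFun_of_covariance_eq_zero fun i j hij => ?_
    refine (covariance_dotProduct P (T i) (T j)).trans ?_
    have := hT hij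
    rw [Matrix.mul_assoc, Matrix.mul_apply] at this
    rw [← this, dotProduct]
    rfl
  have hmap := (iIndepFun_iff_map_fun_eq_pi_map fun i => (hi i).aemeasurable).1 hind
  have key (i : n) : ∃ (m : ℝ) (v : NNReal),
      P.map (fun x => (T *ᵥ x.ofLp) i) = gaussianReal m v := ⟨_, _, (hi i).map_eq_gaussianReal⟩
  choose m v hmv using key
  refine ⟨m, v, hmap.trans ?_⟩
  rw [funext hmv]

end Diagonalization

/-- The dimension-free excess risk bound for arbitrary, possibly degenerate, Gaussian classes. -/
lemma exists_mul_pow_eight_le_excessRisk_of_isGaussian {c₁ : ℝ} (hc₁ : 0 < c₁) :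
    ∃ c : ℝ, 0 < c ∧ ∀ (p : ℕ) (P₁ P₀ : Measure (EuclideanSpace ℝ (Fin p))),
      IsGaussian P₁ → IsGaussian P₀ → c₁ < l1Dist P₁ P₀ →
      ∀ g : EuclideanSpace ℝ (Fin p) → Fin 2, Measurable g →
        min (c * learningError P₁ P₀ g ^ 8) (learningError P₁ P₀ g / 8) ≤ excessRisk P₁ P₀ g := by
  obtain ⟨c, hc, H⟩ := exists_mul_pow_eight_le_excessRisk hc₁
  refine ⟨c, hc, fun p P₁ P₀ h1 h0 hd g hg => ?_⟩
  obtain ⟨T, T', hTT', hT'T, d1, d0⟩ := exists_simultaneous_diagonalization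
    (posSemidef_covarianceMatrix P₁) (posSemidef_covarianceMatrix P₀)
  obtain ⟨m₁, w, e1⟩ := exists_map_mulVec_eq_pi P₁ d1
  obtain ⟨m₀, v, e0⟩ := exists_map_mulVec_eq_pi P₀ d0
  have mS : Measurable fun x : EuclideanSpace ℝ (Fin p) => T *ᵥ x.ofLp := by fun_prop
  have mF : Measurable fun y : Fin p → ℝ => WithLp.toLp 2 (T' *ᵥ y) := by fun_prop
  have back (P : Measure (EuclideanSpace ℝ (Fin p))) :
      P = (P.map fun x => T *ᵥ x.ofLp).map fun y => WithLp.toLp 2 (T' *ᵥ y) := by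
    rw [Measure.map_map mF mS]
    have : (fun y : Fin p → ℝ => WithLp.toLp 2 (T' *ᵥ y)) ∘
        (fun x : EuclideanSpace ℝ (Fin p) => T *ᵥ x.ofLp) = id := by
      ext x i
      simp [mulVec_mulVec, hT'T]
    rw [this, Measure.map_id]
  refine H (Fin p) _ m₁ m₀ w v (fun y => WithLp.toLp 2 (T' *ᵥ y)) (fun x => T *ᵥ x.ofLp) mF mS
    (fun y => ?_) P₁ P₀ ?_ ?_ hd g hg
  · simp [mulVec_mulVec, hTT']
  · rw [← e1]; exact back P₁
  · rw [← e0]; exact back P₀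

section EqualCovariance

variable {p : ℕ}

/-- The Cameron–Martin formula for the standard Gaussian measure. -/
lemma map_add_stdGaussian (h : EuclideanSpace ℝ (Fin p)) :
    (stdGaussian (EuclideanSpace ℝ (Fin p))).map (fun z => h + z) =
      (stdGaussian (EuclideanSpace ℝ (Fin p))).withDensity fun z =>
        ENNReal.ofReal (Real.exp (inner ℝ h z - ‖h‖ ^ 2 / 2)) := by
  have hden (i : Fin p) : gaussianReal (h i) 1 = (gaussianReal 0 1).withDensity fun x =>
      ENNReal.ofReal (Real.exp (h i * x - h i ^ 2 / 2)) := by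
    refine (gaussianReal_eq_withDensity (m₀ := 0) one_ne_zero one_ne_zero).trans ?_
    congr 1
    ext x
    rw [log_gaussianPDFReal one_ne_zero, log_gaussianPDFReal one_ne_zero]
    congr 2
    push_cast
    ring
  have hpi := pi_withDensity_exp (fun _ : Fin p => gaussianReal 0 1) (fun i => gaussianReal (h i) 1)
    (fun i x => h i * x - h i ^ 2 / 2) (fun i => by fun_prop) hden
  have hshift : Measure.pi (fun i => gaussianReal (h i) 1) =
      (Measure.pi fun _ : Fin p => gaussianReal 0 1).map fun y i => h i + y i := by
    rw [Measure.pi_map_pi (f := fun i y => h i + y) (fun i => by fun_prop)]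
    congr 1
    ext1 i
    rw [gaussianReal_map_const_add, zero_add]
  have mL : Measurable (WithLp.toLp 2 : (Fin p → ℝ) → EuclideanSpace ℝ (Fin p)) := by fun_prop
  have h1 := map_withDensity_eq_withDensity_map (Q := Measure.pi fun _ : Fin p => gaussianReal 0 1)
    mL (S := fun x : EuclideanSpace ℝ (Fin p) => x.ofLp) (by fun_prop) (fun y => rfl)
    (f := fun x => ENNReal.ofReal (Real.exp (∑ i, (h i * x i - h i ^ 2 / 2)))) (by fun_prop)
  rw [← hpi, hshift, Measure.map_map mL (by fun_prop), map_pi_eq_stdGaussian] at h1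
  rw [← map_pi_eq_stdGaussian, Measure.map_map (by fun_prop) mL, map_pi_eq_stdGaussian]
  refine Eq.trans ?_ (h1.trans ?_)
  · rfl
  · congr 1
    ext x
    congr 2
    rw [Finset.sum_sub_distrib, EuclideanSpace.real_norm_sq_eq, ← Finset.sum_div,
      PiLp.inner_apply]
    congr 1
    refine Finset.sum_congr rfl fun i _ => ?_
    simp [mul_comm]

lemma map_inner_stdGaussian (h : EuclideanSpace ℝ (Fin p)) (c : ℝ) :
    (stdGaussian (EuclideanSpace ℝ (Fin p))).map (fun z => inner ℝ h z + c) =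
      gaussianReal c (‖h‖ ^ 2).toNNReal := by
  have h1 := IsGaussian.map_eq_gaussianReal (μ := stdGaussian (EuclideanSpace ℝ (Fin p)))
    (innerSL ℝ h)
  rw [integral_strongDual_stdGaussian, variance_dual_stdGaussian, innerSL_apply_norm] at h1
  have h2 := congrArg (Measure.map fun y : ℝ => y + c) h1
  rw [Measure.map_map (by fun_prop) (by fun_prop), gaussianReal_map_add_const, zero_add] at h2
  exact h2

/-- Two Gaussian classes with a common covariance: the log-likelihood ratio has, under the second
class, the law `N(-δ² / 2, δ²)`, where `δ` is the whitened distance of the means. -/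
lemma exists_logLikelihood_of_posDef {C : Matrix (Fin p) (Fin p) ℝ} (hC : C.PosDef)
    (μ₁ μ₀ : EuclideanSpace ℝ (Fin p)) :
    ∃ l : EuclideanSpace ℝ (Fin p) → ℝ, Measurable l ∧
      multivariateGaussian μ₁ C = (multivariateGaussian μ₀ C).withDensity
        (fun x => ENNReal.ofReal (Real.exp (l x))) ∧
      (multivariateGaussian μ₀ C).map l =
        gaussianReal (-(whitenedNorm C (μ₁ - μ₀) ^ 2 / 2))
          (whitenedNorm C (μ₁ - μ₀) ^ 2).toNNReal := by
  have hdet : IsUnit (CFC.sqrt C).det := by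
    have h1 : CFC.sqrt C * CFC.sqrt C = C := CFC.sqrt_mul_sqrt_self C hC.posSemidef.nonneg
    have h2 : IsUnit C.det := (isUnit_iff_isUnit_det C).1 hC.isUnit
    rw [← h1, det_mul] at h2
    exact isUnit_of_mul_isUnit_left h2
  set A := toEuclideanCLM (𝕜 := ℝ) (CFC.sqrt C) with hA
  set A' := toEuclideanCLM (𝕜 := ℝ) (CFC.sqrt C)⁻¹ with hA'
  have hA'A (z : EuclideanSpace ℝ (Fin p)) : A' (A z) = z := by
    rw [← mul_apply_eq_comp, hA, hA', ← map_mul, nonsing_inv_mul _ hdet, map_one]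
    rfl
  have hAA' (z : EuclideanSpace ℝ (Fin p)) : A (A' z) = z := by
    rw [← mul_apply_eq_comp, hA, hA', ← map_mul, mul_nonsing_inv _ hdet, map_one]
    rfl
  set h := A' (μ₁ - μ₀) with hh
  have hδ : whitenedNorm C (μ₁ - μ₀) = ‖h‖ := rfl
  have mF : Measurable fun z => μ₀ + A z := by fun_prop
  have mS : Measurable fun x => A' (x - μ₀) := by fun_prop
  have hSF (z : EuclideanSpace ℝ (Fin p)) : A' (μ₀ + A z - μ₀) = z := by simp [hA'A]
  have e0 : multivariateGaussian μ₀ C =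
    (stdGaussian (EuclideanSpace ℝ (Fin p))).map fun z => μ₀ + A z := rfl
  have e1 : multivariateGaussian μ₁ C =
      ((stdGaussian (EuclideanSpace ℝ (Fin p))).map fun z => h + z).map fun z => μ₀ + A z := by
    rw [Measure.map_map mF (by fun_prop)]
    change (stdGaussian (EuclideanSpace ℝ (Fin p))).map (fun z => μ₁ + A z) = _
    congr 1
    ext1 z
    rw [Function.comp_apply, map_add, hh, hAA']
    abel
  refine ⟨fun x => inner ℝ h (A' (x - μ₀)) - ‖h‖ ^ 2 / 2, by fun_prop, ?_, ?_⟩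
  · rw [e1, map_add_stdGaussian, map_withDensity_eq_withDensity_map mF mS hSF (by fun_prop), e0]
  · rw [e0, Measure.map_map (by fun_prop) mF, hδ, ← map_inner_stdGaussian h]
    congr 1
    ext z
    simp [hA'A, sub_eq_add_neg]

lemma gaussianPDFReal_neg_half_le {δ t x : ℝ} (hδ : 0 < δ) (hx : |x| ≤ t) :
    gaussianPDFReal (-(δ ^ 2 / 2)) (δ ^ 2).toNNReal x ≤
      Real.exp (t / 2) * (Real.sqrt (2 * Real.pi) * δ * Real.exp (δ ^ 2 / 8))⁻¹ := by
  rw [gaussianPDFReal_def, Real.coe_toNNReal _ (sq_nonneg δ),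
    Real.sqrt_mul (by positivity : 0 ≤ 2 * Real.pi),
    Real.sqrt_sq hδ.le, mul_inv _ (Real.exp (δ ^ 2 / 8)), ← Real.exp_neg,
    mul_left_comm (Real.exp (t / 2)), ← Real.exp_add]
  refine mul_le_mul_of_nonneg_left (Real.exp_le_exp.2 ?_) (by positivity)
  have e : -(x - -(δ ^ 2 / 2)) ^ 2 / (2 * δ ^ 2) =
      -(x / 2) + -(δ ^ 2 / 8) - x ^ 2 / (2 * δ ^ 2) := by
    field_simp; ring
  rw [e]
  have h1 : 0 ≤ x ^ 2 / (2 * δ ^ 2) := by positivity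
  have h2 := neg_le_abs x
  linarith

/-- The excess risk bound for a common covariance: the density of the log-likelihood ratio near the
origin is of the order `exp (-δ² / 8) / δ`. -/
lemma min_le_excessRisk_of_posDef {C : Matrix (Fin p) (Fin p) ℝ} (hC : C.PosDef)
    (μ₁ μ₀ : EuclideanSpace ℝ (Fin p)) {g : EuclideanSpace ℝ (Fin p) → Fin 2} (hg : Measurable g) :
    min
      (Real.sqrt (2 * Real.pi) / (2 * 16 ^ 2) * whitenedNorm C (μ₁ - μ₀)
        * Real.exp (whitenedNorm C (μ₁ - μ₀) ^ 2 / 8)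
        * learningError (multivariateGaussian μ₁ C) (multivariateGaussian μ₀ C) g ^ 2)
      (learningError (multivariateGaussian μ₁ C) (multivariateGaussian μ₀ C) g / 8)
    ≤ excessRisk (multivariateGaussian μ₁ C) (multivariateGaussian μ₀ C) g := by
  obtain ⟨l, hl, hden, hlaw⟩ := exists_logLikelihood_of_posDef hC μ₁ μ₀
  have hδ0 : 0 ≤ whitenedNorm C (μ₁ - μ₀) := norm_nonneg _
  generalize whitenedNorm C (μ₁ - μ₀) = δ at *
  have hE := excessRisk_nonneg (multivariateGaussian μ₁ C) (multivariateGaussian μ₀ C) hg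
  have hR0 := learningError_nonneg (multivariateGaussian μ₁ C) (multivariateGaussian μ₀ C) g
  rcases hδ0.eq_or_lt with rfl | hδ
  · refine (min_le_left _ _).trans (le_of_eq_of_le ?_ hE)
    simp
  set J := Real.sqrt (2 * Real.pi) * δ * Real.exp (δ ^ 2 / 8) with hJ
  have hJ0 : 0 < J := by positivity
  have hball {ε : ℝ} (h0 : 0 < ε) (h1 : ε ≤ 1 / 4) :
      (multivariateGaussian μ₀ C).real {x | |l x| ≤ 2 * ε} ≤ 8 * ε * J⁻¹ := by
    have e : (multivariateGaussian μ₀ C).real {x | |l x| ≤ 2 * ε} =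
        (gaussianReal (-(δ ^ 2 / 2)) (δ ^ 2).toNNReal).real {y | |y| ≤ 2 * ε} := by
      rw [← hlaw, map_measureReal_apply hl (measurableSet_le (by fun_prop) measurable_const)]
      rfl
    have he : Real.exp (2 * ε / 2) ≤ 2 := by
      refine (Real.exp_le_exp.2 (by linarith : 2 * ε / 2 ≤ 1 / 2)).trans ?_
      have := Real.exp_bound_div_one_sub_of_interval (x := 1 / 2) (by norm_num) (by norm_num)
      norm_num at this ⊢
      exact this
    rw [e]
    refine (gaussianReal_real_abs_le (B := 2 * J⁻¹) ?_ (by positivity) (by positivity)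
      fun x hx => ?_).trans_eq (by ring)
    · exact (Real.toNNReal_pos.2 (by positivity)).ne'
    · refine (gaussianPDFReal_neg_half_le hδ hx).trans ?_
      gcongr
  have key {ε : ℝ} (h0 : 0 < ε) (h1 : ε ≤ 1 / 4) := mul_sub_le_excessRisk hl hden hg h0 h1
  set R := learningError (multivariateGaussian μ₁ C) (multivariateGaussian μ₀ C) g
  set x := excessRisk (multivariateGaussian μ₁ C) (multivariateGaussian μ₀ C) g
  rcases hR0.eq_or_lt with h0 | h0
  · refine (min_le_right _ _).trans (le_of_eq_of_le ?_ hE)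
    rw [← h0, zero_div]
  -- the discarded mass `12 * ε / J` is at most `R / 2` for `ε = R * J / 24`
  rcases le_total (1 / 4) (R * J / 24) with hcase | hcase
  · refine (min_le_right _ _).trans ?_
    have k1 := key (ε := 1 / 4) (by norm_num) le_rfl
    have k2 := hball (ε := 1 / 4) (by norm_num) le_rfl
    have k3 : J⁻¹ ≤ R / 6 := by
      rw [inv_le_iff_one_le_mul₀ hJ0]
      linarith
    linarith
  · refine (min_le_left _ _).trans ?_
    have k1 := key (ε := R * J / 24) (by positivity) hcase
    have k2 := hball (ε := R * J / 24) (by positivity) hcase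
    have k3 : 8 * (R * J / 24) * J⁻¹ = R / 3 := by field_simp; norm_num
    rw [k3] at k2
    have k4 : R * J / 24 * (R / 2) ≤ x := by
      refine le_trans ?_ k1
      gcongr
      linarith
    have k5 : Real.sqrt (2 * Real.pi) / (2 * 16 ^ 2) * δ * Real.exp (δ ^ 2 / 8) * R ^ 2 =
        J * R ^ 2 / 512 := by rw [hJ]; ring
    have k6 : 0 ≤ J * R ^ 2 := by positivity
    rw [k5]
    linarith

end EqualCovariance

end GaussianClassification

theorem mainTheorem4 :
    (∀ (p : ℕ) (C : Matrix (Fin p) (Fin p) ℝ) (μ₁ μ₀ : EuclideanSpace ℝ (Fin p))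
      (g : EuclideanSpace ℝ (Fin p) → Fin 2), C.PosDef → Measurable g →
      min
        (Real.sqrt (2 * Real.pi) / (2 * 16 ^ 2)
          * GaussianClassification.whitenedNorm C (μ₁ - μ₀)
          * Real.exp (GaussianClassification.whitenedNorm C (μ₁ - μ₀) ^ 2 / 8)
          * GaussianClassification.learningError
              (multivariateGaussian μ₁ C) (multivariateGaussian μ₀ C) g ^ 2)
        (GaussianClassification.learningError
            (multivariateGaussian μ₁ C) (multivariateGaussian μ₀ C) g / 8)
      ≤ GaussianClassification.excessRisk
          (multivariateGaussian μ₁ C) (multivariateGaussian μ₀ C) g)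
    ∧
    (∀ c₁ : ℝ, 0 < c₁ → ∃ c : ℝ, 0 < c ∧
      ∀ (p : ℕ) (P₁ P₀ : Measure (EuclideanSpace ℝ (Fin p))),
        IsGaussian P₁ → IsGaussian P₀ →
        c₁ < GaussianClassification.l1Dist P₁ P₀ →
        ∀ g : EuclideanSpace ℝ (Fin p) → Fin 2, Measurable g →
          min (c * GaussianClassification.learningError P₁ P₀ g ^ 8)
            (GaussianClassification.learningError P₁ P₀ g / 8)
          ≤ GaussianClassification.excessRisk P₁ P₀ g) :=
  ⟨fun _ _ μ₁ μ₀ _ hC hg =>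
      GaussianClassification.min_le_excessRisk_of_posDef hC μ₁ μ₀ hg,
    fun _ hc₁ => GaussianClassification.exists_mul_pow_eight_le_excessRisk_of_isGaussian hc₁⟩
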